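/- Let $n\ge 1$ be an integer and let $k>0$, $a>0$ and $a_1$ be real numbers with $a+a_1>0$. Consider the random symmetric tridiagonal matrix $$T=\begin{bmatrix} \mathsf a_n & b_{n-1} & & & \\ b_{n-1} & \mathsf a_{n-1} & b_{n-2} & & \\ & \ddots & \ddots & \ddots & \\ & & b_2 & \mathsf a_2 & b_1\\ & & & b_1 & \mathsf a_1\end{bmatrix},$$ where $\mathsf a_1,\dots,\mathsf a_n,b_1^2,\dots,b_{n-1}^2$ are independent real random variables with $$\mathsf a_i\sim \mathrm N\Big[0,\tfrac1{\sqrt{2(a+a_1)}}\Big]\ (1\le i\le n-1),\qquad b_{i-1}^2\sim\Gamma\Big[\tfrac1{2(a+a_1)};(i-1)k\Big]\ (2\le i\le n-1),$$ $$\mathsf a_n\sim \mathrm N\Big[0,\tfrac1{\sqrt{2a}}\Big],\qquad b_{n-1}^2\sim\Gamma\Big[\tfrac1{2a};(n-1)k\Big]\ (\text{if } n\ge2).$$ Here $\mathrm N[0,\sigma]$ is the centred normal law with standard deviation $\sigma$, and $\Gamma[\sigma;s]$ is the gamma law with density proportional to $x^{s-1}e^{-x/\sigma}$ on $x>0$.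 Let $x_1\ge\dots\ge x_n$ be the eigenvalues of $T$ and let $y_1\ge\dots\ge y_{n-1}$ be the eigenvalues of its bottom right $(n-1)\times(n-1)$ submatrix. Then the joint law of $(x,y)\in\mathbb R^n\times\mathbb R^{n-1}$ is absolutely continuous with respect to Lebesgue measure, and its density is $$\Big(\frac a\pi\Big)^{1/2}\frac{(2a)^{(n-1)k}}{\Gamma(k)^{n-1}}\,\frac{(n-1)!}{M_{n-1}(k;2(a+a_1))}\prod_{i=1}^n e^{-ax_i^2}\prod_{1\le i<j\le n}|x_j-x_i|\prod_{i=1}^{n-1}e^{-a_1y_i^2}\prod_{1\le i<j\le n-1}|y_j-y_i|\prod_{i=1}^n\prod_{j=1}^{n-1}|x_i-y_j|^{k-1}$$ on the interlaced region $x_1>y_1>x_2>y_2>\dots>y_{n-1}>x_n$ and $0$ elsewhere, where $$M_N(k;c)=\int_{\mathbb R^N}e^{-(c/2)\sum_{l=1}^N x_l^2}\prod_{1\le i<j\le N}|x_j-x_i|^{2k}\,dx_1\cdots dx_N .$$ -/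

import Mathlib

open MeasureTheory ProbabilityTheory
open scoped Nat

namespace GaussTridiag

noncomputable section

/-- The symmetric tridiagonal matrix of size `m + 1` whose diagonal reads, from the top left to the
bottom right, `d m, …, d 1, d 0`, and whose off-diagonal reads `b (m - 1), …, b 1, b 0`.
(Indices are zero-based: with `n = m + 1`, the entry `d i` is `a_{i+1}` and `b i` is `b_{i+1}` in the
usual notation, where the diagonal reads `a_n, …, a_1` and the off-diagonal `b_{n-1}, …, b_1`.) -/
def tridiag {m : ℕ} (d : Fin (m + 1) → ℝ) (b : Fin m → ℝ) :
    Matrix (Fin (m + 1)) (Fin (m + 1)) ℝ :=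
  Matrix.of fun i j =>
    if i = j then d i.rev
    else if h : (i : ℕ) + 1 = j then b (Fin.rev ⟨i, by omega⟩)
    else if h : (j : ℕ) + 1 = i then b (Fin.rev ⟨j, by omega⟩)
    else 0

theorem tridiag_isHermitian {m : ℕ} (d : Fin (m + 1) → ℝ) (b : Fin m → ℝ) :
    (tridiag d b).IsHermitian := by
  ext i j
  simp only [Matrix.conjTranspose_apply, tridiag, Matrix.of_apply, star_trivial]
  by_cases hij : i = j
  · subst hij; simp
  · have hji : ¬ j = i := fun h => hij h.symm
    simp only [hij, hji, if_false]
    by_cases h1 : (i : ℕ) + 1 = j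
    · have h2 : ¬ (j : ℕ) + 1 = i := by omega
      simp [h1, h2]
    · by_cases h2 : (j : ℕ) + 1 = i
      · simp [h1, h2]
      · simp [h1, h2]

/-- The bottom right submatrix, obtained by deleting the first row and the first column. -/
def bottomRight {m : ℕ} (A : Matrix (Fin (m + 1)) (Fin (m + 1)) ℝ) : Matrix (Fin m) (Fin m) ℝ :=
  A.submatrix Fin.succ Fin.succ

theorem bottomRight_isHermitian {m : ℕ} {A : Matrix (Fin (m + 1)) (Fin (m + 1)) ℝ}
    (hA : A.IsHermitian) : (bottomRight A).IsHermitian :=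
  hA.submatrix Fin.succ

/-- The eigenvalues of a real symmetric matrix, with multiplicity, in decreasing order. -/
def orderedEigenvalues {n : ℕ} {A : Matrix (Fin n) (Fin n) ℝ} (hA : A.IsHermitian) : Fin n → ℝ :=
  fun i => hA.eigenvalues₀ (i.cast (Fintype.card_fin n).symm)

/-- The product of `|x j - x i|` over all `i < j`. -/
def absVandermonde {n : ℕ} (x : Fin n → ℝ) : ℝ :=
  ∏ i, ∏ j ∈ Finset.Ioi i, |x j - x i|

/-- `M_n(k;c) = ∫_{ℝⁿ} exp (-(c/2) ∑ x_l²) ∏_{i<j} |x_j - x_i|^{2k} dx`. -/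
def mehtaIntegral (n : ℕ) (k c : ℝ) : ℝ :=
  ∫ x : Fin n → ℝ, Real.exp (-(c / 2) * ∑ l, x l ^ 2) * absVandermonde x ^ (2 * k)

/-- The pairs `(x, y)` with `x_1 > y_1 > x_2 > y_2 > ⋯ > y_m > x_{m+1}`. -/
def interlaced (m : ℕ) : Set ((Fin (m + 1) → ℝ) × (Fin m → ℝ)) :=
  {p | ∀ i : Fin m, p.1 i.castSucc > p.2 i ∧ p.2 i > p.1 i.succ}

/-- The density of the Gaussian interlaced ensemble `(x, y) ∈ ℝ^{m+1} × ℝ^m` with parameters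
`k, a, a₁`, with respect to Lebesgue measure. It is supported on the ordered, interlaced
configurations; since `mehtaIntegral` integrates over all (unordered) configurations, the
normalization carries the factor `m !`. -/
def interlacedPDF (m : ℕ) (k a a₁ : ℝ) : (Fin (m + 1) → ℝ) × (Fin m → ℝ) → ℝ :=
  (interlaced m).indicator fun p =>
    Real.sqrt (a / Real.pi) * ((2 * a) ^ ((m : ℝ) * k) / Real.Gamma k ^ m)
      * ((m ! : ℝ) / mehtaIntegral m k (2 * (a + a₁)))
      * (∏ i, Real.exp (-a * p.1 i ^ 2)) * absVandermonde p.1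
      * (∏ i, Real.exp (-a₁ * p.2 i ^ 2)) * absVandermonde p.2
      * ∏ i, ∏ j, |p.1 i - p.2 j| ^ (k - 1)

/-- The Gaussian interlaced ensemble as a measure on `ℝ^{m+1} × ℝ^m`. -/
def interlacedEnsemble (m : ℕ) (k a a₁ : ℝ) : Measure ((Fin (m + 1) → ℝ) × (Fin m → ℝ)) :=
  volume.withDensity fun p => ENNReal.ofReal (interlacedPDF m k a a₁ p)

end

end GaussTridiag

/-! The proof is by induction on the size. Deleting the first row and column of T leaves a matrix of
the same kind, with parameters `a + a₁` and `0`. Let y and z be the spectra of that matrix and of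
its own bottom right submatrix; let α and s be the new diagonal entry and the square of the new
off-diagonal entry. Expanding the determinant, the spectrum x of T satisfies ∏ (t - x_i) / ∏ (t -
y_j) = t - α - s ∏ (t - z_j) / ∏ (t - y_j) = t - α - ∑ c_j / (t - y_j). For fixed y this factors the
passage from (z, α, s) to x through two changes of variables, (s, z) ↦ c (`residues`) and x ↦ (α, c)
(`secular`). Each is a bijection from strictly interlaced configurations (with s > 0 in the first)
onto the region where all c_j are positive. Both Jacobians reduce to a Cauchy determinant bordered
by ones; writing V for `absVandermonde`, they are s^m V(z) / V(y) and V(x) / V(y)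
(`lintegral_residues`, `lintegral_secular`).

The first change turns the Gamma law of s, of shape (m + 1)k, and the density of (y, z) into a
function of y times independent Gamma densities of shape k in the c_j
(`gammaDensity_mul_interlacedPDF`). The second, with the identity ∑ x² = α² + 2 ∑ c + ∑ y²
(`sum_sq_secular`), produces the claimed density of (x, y) (`gaussianPDF_mul_prod_gammaDensity`).

The constant needs no evaluation of a Selberg-type integral. Integrating out z gives the density of
y up to an explicit constant; since the total mass is one by induction, this constant is the
factorial divided by the Mehta integral of the next size (`betaConst_eq`). -/

namespace GaussTridiag

open scoped ENNReal

/-! ### Recovering ordered roots from the values of a polynomial -/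

/-- The values at the natural numbers of the monic polynomial with roots `x`. -/
noncomputable def rootValues {n : ℕ} (x : Fin n → ℝ) (t : ℕ) : ℝ := ∏ i, ((t : ℝ) - x i)

theorem continuous_rootValues (n : ℕ) : Continuous (rootValues (n := n)) := by
  unfold rootValues
  fun_prop

/-- Agreement at infinitely many points forces the two polynomials to coincide, hence their root
multisets; a decreasing list is determined by its multiset. -/
theorem eq_of_rootValues_eq {n : ℕ} {x x' : Fin n → ℝ} (hx : Antitone x) (hx' : Antitone x')
    (h : rootValues x = rootValues x') : x = x' := by
  have hp : (∏ i, (Polynomial.X - Polynomial.C (x i)))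
      = ∏ i, (Polynomial.X - Polynomial.C (x' i)) := by
    refine Polynomial.eq_of_infinite_eval_eq _ _
      (Set.Infinite.mono ?_ (Set.infinite_range_of_injective (Nat.cast_injective (R := ℝ))))
    rintro _ ⟨t, rfl⟩
    have := congrFun h t
    simpa [Polynomial.eval_prod, rootValues] using this
  have hm : (Finset.univ.val.map x) = Finset.univ.val.map x' := by
    have h1 : ∀ w : Fin n → ℝ, (∏ i, (Polynomial.X - Polynomial.C (w i))).roots
        = Finset.univ.val.map w := fun w => by
      rw [← Polynomial.roots_multiset_prod_X_sub_C (Finset.univ.val.map w), Multiset.map_map]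
      rfl
    rw [← h1, ← h1, hp]
  have hl : List.ofFn x = List.ofFn x' := by
    refine List.Perm.eq_of_pairwise' (r := fun a b : ℝ => b ≤ a) ?_ ?_ ?_
    · exact List.pairwise_ofFn.2 fun i j hij => hx hij.le
    · exact List.pairwise_ofFn.2 fun i j hij => hx' hij.le
    · rw [← Multiset.coe_eq_coe]
      simpa [Fin.univ_val_map] using hm
  exact List.ofFn_injective hl

/-- A continuous injection on a Borel set is a measurable embedding (Lusin–Souslin), so its inverse
extends measurably. This is why polynomials are encoded by countably many values: measurability of
the ordered eigenvalues then follows from that of determinants. -/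
theorem exists_rootsOfValues (n : ℕ) : ∃ R : (ℕ → ℝ) → (Fin n → ℝ), Measurable R ∧
    ∀ x : Fin n → ℝ, Antitone x → R (rootValues x) = x := by
  have hs : MeasurableSet {x : Fin n → ℝ | Antitone x} := by
    apply IsClosed.measurableSet
    simp only [Antitone, Set.ofPred_forall]
    refine isClosed_iInter fun i => isClosed_iInter fun j => isClosed_iInter fun _ => ?_
    exact isClosed_le (continuous_apply _) (continuous_apply _)
  have he := (continuous_rootValues n).continuousOn.measurableEmbedding hs
    fun x hx x' hx' h => eq_of_rootValues_eq hx hx' h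
  obtain ⟨R, hR, hR'⟩ := he.exists_measurable_extend (g := Subtype.val) measurable_subtype_coe
    fun _ => ⟨0⟩
  exact ⟨R, hR, fun x hx => congrFun hR' ⟨x, hx⟩⟩

/-- A measurable inverse of `rootValues` on the decreasingly ordered vectors. -/
noncomputable def rootsOfValues (n : ℕ) : (ℕ → ℝ) → (Fin n → ℝ) := (exists_rootsOfValues n).choose

theorem measurable_rootsOfValues (n : ℕ) : Measurable (rootsOfValues n) :=
  (exists_rootsOfValues n).choose_spec.1

theorem rootsOfValues_rootValues {n : ℕ} {x : Fin n → ℝ} (hx : Antitone x) :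
    rootsOfValues n (rootValues x) = x :=
  (exists_rootsOfValues n).choose_spec.2 x hx

/-! ### Eigenvalues -/

theorem orderedEigenvalues_antitone {n : ℕ} {A : Matrix (Fin n) (Fin n) ℝ} (hA : A.IsHermitian) :
    Antitone (orderedEigenvalues hA) :=
  fun _ _ hij => hA.eigenvalues₀_antitone hij

theorem prod_sub_orderedEigenvalues {n : ℕ} {A : Matrix (Fin n) (Fin n) ℝ} (hA : A.IsHermitian)
    (t : ℝ) : ∏ i, (t - orderedEigenvalues hA i) = (Matrix.scalar (Fin n) t - A).det := by
  rw [← Matrix.eval_charpoly, hA.charpoly_eq, Polynomial.eval_prod]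
  simp only [Polynomial.eval_sub, Polynomial.eval_X, Polynomial.eval_C, RCLike.ofReal_real_eq_id, id]
  unfold Matrix.IsHermitian.eigenvalues orderedEigenvalues
  rw [Equiv.prod_comp (Fintype.equivOfCardEq (Fintype.card_fin _)).symm
    fun i => t - hA.eigenvalues₀ i]
  exact Fintype.prod_equiv (finCongr (Fintype.card_fin n).symm) _ _ fun i => rfl

theorem orderedEigenvalues_eq_rootsOfValues {n : ℕ} {A : Matrix (Fin n) (Fin n) ℝ}
    (hA : A.IsHermitian) : orderedEigenvalues hA
      = rootsOfValues n fun t => (Matrix.scalar (Fin n) (t : ℝ) - A).det := by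
  rw [← rootsOfValues_rootValues (orderedEigenvalues_antitone hA)]
  congr 1
  funext t
  exact prod_sub_orderedEigenvalues hA t

/-! ### The three-term recurrence -/

theorem bottomRight_tridiag {m : ℕ} (d : Fin (m + 2) → ℝ) (b : Fin (m + 1) → ℝ) :
    bottomRight (tridiag d b) = tridiag (fun i => d i.castSucc) (fun i => b i.castSucc) := by
  ext i j
  simp only [bottomRight, tridiag, Matrix.submatrix_apply, Matrix.of_apply, Fin.succ_inj,
    Fin.val_succ, add_left_inj, Fin.rev_succ]
  congr 1
  split_ifs with h1 h2
  · congr 1; ext; simp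
  · congr 1; ext; simp
  · rfl

/-- Laplace expansion along the first row, whose only nonzero entries are the first two; the second
minor is expanded along its first column. -/
theorem det_scalar_sub_tridiag {m : ℕ} (d : Fin (m + 2) → ℝ) (b : Fin (m + 1) → ℝ) (t : ℝ) :
    (Matrix.scalar _ t - tridiag d b).det
      = (t - d (Fin.last _)) * (Matrix.scalar _ t - bottomRight (tridiag d b)).det
        - b (Fin.last _) ^ 2
          * (Matrix.scalar _ t - bottomRight (bottomRight (tridiag d b))).det := by
  set A := Matrix.scalar (Fin (m + 2)) t - tridiag d b with hA
  have h0 : A 0 0 = t - d (Fin.last _) := by simp [hA, tridiag]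
  have h1 : A 0 1 = - b (Fin.last _) := by
    simp [hA, tridiag, Matrix.diagonal]
  have h2 : A 1 0 = - b (Fin.last _) := by
    simp [hA, tridiag, Matrix.diagonal]
  have h3 : ∀ j : Fin m, A 0 j.succ.succ = 0 := by
    intro j
    have e1 : ¬ (0 : Fin (m + 2)) = j.succ.succ := (Fin.succ_ne_zero _).symm
    simp [hA, tridiag, Matrix.diagonal, e1]
  have h4 : ∀ j : Fin m, A j.succ.succ 0 = 0 := by
    intro j
    have e2 : ¬ j.succ.succ = (0 : Fin (m + 2)) := Fin.succ_ne_zero _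
    simp [hA, tridiag, Matrix.diagonal, e2]
  have hs : A.submatrix Fin.succ Fin.succ
      = Matrix.scalar _ t - bottomRight (tridiag d b) := by
    ext i j; simp [hA, bottomRight, Matrix.diagonal]
  have hs2 : (A.submatrix Fin.succ (Fin.succAbove 1)).submatrix Fin.succ Fin.succ
      = Matrix.scalar _ t - bottomRight (bottomRight (tridiag d b)) := by
    ext i j
    simp [hA, bottomRight, Matrix.diagonal]
  rw [Matrix.det_succ_row_zero, Fin.sum_univ_succ, Fin.sum_univ_succ]
  simp only [h3, Fin.succ_zero_eq_one, Fin.succAbove_zero, hs, h0, h1]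
  rw [Matrix.det_succ_column_zero (A.submatrix Fin.succ (Fin.succAbove 1)), Fin.sum_univ_succ]
  simp only [Fin.succAbove_zero, hs2, Matrix.submatrix_apply, Fin.one_succAbove_zero, h4,
    Fin.succ_zero_eq_one, h2]
  simp
  ring

/-- The signs of the off-diagonal entries are unspecified, only the laws of their squares being
given. The recurrence has two steps, so the induction carries the matrix and its submatrix together.
-/
theorem det_scalar_sub_tridiag_congr {m : ℕ} (d : Fin (m + 1) → ℝ) {b b' : Fin m → ℝ}
    (h : ∀ i, b i ^ 2 = b' i ^ 2) (t : ℝ) :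
    (Matrix.scalar _ t - tridiag d b).det = (Matrix.scalar _ t - tridiag d b').det ∧
    (Matrix.scalar _ t - bottomRight (tridiag d b)).det
      = (Matrix.scalar _ t - bottomRight (tridiag d b')).det := by
  induction m with
  | zero => rw [Subsingleton.elim b b']; simp
  | succ m ih =>
    have ih' := ih (fun i => d i.castSucc) (fun i => h i.castSucc)
    simp only [← bottomRight_tridiag] at ih'
    refine ⟨?_, ih'.1⟩
    rw [det_scalar_sub_tridiag, det_scalar_sub_tridiag, ih'.1, ih'.2, h]

/-- The ordered eigenvalues of the tridiagonal matrix and of its bottom right submatrix, as a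
function of the diagonal and of the squares of the off-diagonal entries. -/
noncomputable def spectra {m : ℕ} (d : Fin (m + 1) → ℝ) (s : Fin m → ℝ) :
    (Fin (m + 1) → ℝ) × (Fin m → ℝ) :=
  (rootsOfValues _ fun t => (Matrix.scalar _ (t : ℝ) - tridiag d fun i => √(s i)).det,
   rootsOfValues _ fun t => (Matrix.scalar _ (t : ℝ) - bottomRight (tridiag d fun i => √(s i))).det)

theorem spectra_sq {m : ℕ} (d : Fin (m + 1) → ℝ) (b : Fin m → ℝ) :
    spectra d (fun i => b i ^ 2) = (orderedEigenvalues (tridiag_isHermitian d b),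
      orderedEigenvalues (bottomRight_isHermitian (tridiag_isHermitian d b))) := by
  have h : ∀ i, √(b i ^ 2) ^ 2 = b i ^ 2 := fun i => Real.sq_sqrt (sq_nonneg _)
  simp only [spectra, orderedEigenvalues_eq_rootsOfValues,
    (det_scalar_sub_tridiag_congr d h _).1, (det_scalar_sub_tridiag_congr d h _).2]

theorem measurable_det {α : Type*} [MeasurableSpace α] {n : ℕ}
    {A : α → Matrix (Fin n) (Fin n) ℝ} (hA : ∀ i j, Measurable fun a => A a i j) :
    Measurable fun a => (A a).det := by
  simp only [Matrix.det_apply]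
  fun_prop

theorem measurable_spectra (m : ℕ) :
    Measurable fun p : (Fin (m + 1) → ℝ) × (Fin m → ℝ) => spectra p.1 p.2 := by
  have h : ∀ i j, Measurable fun p : (Fin (m + 1) → ℝ) × (Fin m → ℝ) =>
      tridiag p.1 (fun i => √(p.2 i)) i j := by
    intro i j
    simp only [tridiag, Matrix.of_apply]
    split_ifs <;> fun_prop
  refine Measurable.prodMk ?_ ?_
  · refine (measurable_rootsOfValues _).comp (measurable_pi_lambda _ fun t => measurable_det ?_)
    exact fun i j => measurable_const.sub (h i j)
  · refine (measurable_rootsOfValues _).comp (measurable_pi_lambda _ fun t => measurable_det ?_)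
    exact fun i j => measurable_const.sub (h _ _)

/-- The spectrum of the enlarged matrix, as a function of the spectra of the smaller ones and of the
new entries. -/
noncomputable def extend {m : ℕ} (y : Fin (m + 1) → ℝ) (z : Fin m → ℝ) (a s : ℝ) :
    Fin (m + 2) → ℝ :=
  rootsOfValues _ fun t => ((t : ℝ) - a) * rootValues y t - s * rootValues z t

theorem measurable_extend (m : ℕ) : Measurable
    fun p : ((Fin (m + 1) → ℝ) × (Fin m → ℝ)) × (ℝ × ℝ) => extend p.1.1 p.1.2 p.2.1 p.2.2 := by
  refine (measurable_rootsOfValues _).comp (measurable_pi_lambda _ fun t => ?_)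
  simp only [rootValues]
  fun_prop

theorem spectra_succ {m : ℕ} (d : Fin (m + 2) → ℝ) (b : Fin (m + 1) → ℝ) :
    spectra d (fun i => b i ^ 2)
      = (extend (spectra (fun i => d i.castSucc) fun i => b i.castSucc ^ 2).1
          (spectra (fun i => d i.castSucc) fun i => b i.castSucc ^ 2).2
          (d (Fin.last _)) (b (Fin.last _) ^ 2),
        (spectra (fun i => d i.castSucc) fun i => b i.castSucc ^ 2).1) := by
  rw [spectra_sq, spectra_sq (fun i => d i.castSucc) (fun i => b i.castSucc)]
  simp only [Prod.mk.injEq]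
  constructor
  · rw [orderedEigenvalues_eq_rootsOfValues, extend]
    congr 1
    funext t
    simp only [rootValues, prod_sub_orderedEigenvalues, det_scalar_sub_tridiag,
      bottomRight_tridiag]
  · simp only [orderedEigenvalues_eq_rootsOfValues, bottomRight_tridiag]

/-! ### Partial fractions -/

open Polynomial in
/-- The monic polynomial with roots `x`. -/
noncomputable def rootPoly {n : ℕ} (x : Fin n → ℝ) : ℝ[X] := ∏ i, (X - C (x i))

theorem eval_rootPoly {n : ℕ} (x : Fin n → ℝ) (t : ℝ) :
    (rootPoly x).eval t = ∏ i, (t - x i) := by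
  simp [rootPoly, Polynomial.eval_prod]

theorem monic_rootPoly {n : ℕ} (x : Fin n → ℝ) : (rootPoly x).Monic :=
  Polynomial.monic_prod_X_sub_C _ _

theorem natDegree_rootPoly {n : ℕ} (x : Fin n → ℝ) : (rootPoly x).natDegree = n := by
  simp [rootPoly]

theorem degree_rootPoly {n : ℕ} (x : Fin n → ℝ) : (rootPoly x).degree = n := by
  rw [Polynomial.degree_eq_natDegree (monic_rootPoly x).ne_zero, natDegree_rootPoly]

theorem degree_rootPoly_sub_lt {n : ℕ} (x x' : Fin n → ℝ) :
    (rootPoly x - rootPoly x').degree < n := by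
  have h := Polynomial.degree_sub_lt_left (p := rootPoly x) (q := rootPoly x')
    (by rw [degree_rootPoly, degree_rootPoly])
    (monic_rootPoly x).ne_zero (by rw [monic_rootPoly x, monic_rootPoly x'])
  rwa [degree_rootPoly] at h

theorem nextCoeff_rootPoly {n : ℕ} (x : Fin (n + 1) → ℝ) :
    (rootPoly x).coeff n = - ∑ i, x i := by
  rw [← Polynomial.prod_X_sub_C_nextCoeff (s := Finset.univ) x, Polynomial.nextCoeff_of_natDegree_pos]
  · change _ = (rootPoly x).coeff ((rootPoly x).natDegree - 1)
    rw [natDegree_rootPoly]; rfl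
  · change 0 < (rootPoly x).natDegree
    rw [natDegree_rootPoly]; omega

/-- Equal root sums cancel the second coefficient as well as the leading one, so n + 1 nodes suffice
to determine the difference. -/
theorem degree_rootPoly_sub_lt_of_sum_eq {n : ℕ} {x x' : Fin (n + 2) → ℝ}
    (h : ∑ i, x i = ∑ i, x' i) : (rootPoly x - rootPoly x').degree < (n + 1 : ℕ) := by
  rw [Polynomial.degree_lt_iff_coeff_zero]
  intro k hk
  obtain rfl | hk := hk.eq_or_lt
  · rw [Polynomial.coeff_sub, nextCoeff_rootPoly, nextCoeff_rootPoly, h, sub_self]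
  · have := degree_rootPoly_sub_lt x x'
    rw [Polynomial.degree_lt_iff_coeff_zero] at this
    exact this k hk

/-- The derivative at `y j` of the monic polynomial with roots `y`. -/
noncomputable def nodeDeriv {m : ℕ} (y : Fin (m + 1) → ℝ) (j : Fin (m + 1)) : ℝ :=
  ∏ l, (y j - y (j.succAbove l))

theorem nodeDeriv_ne_zero {m : ℕ} {y : Fin (m + 1) → ℝ} (hy : Function.Injective y)
    (j : Fin (m + 1)) : nodeDeriv y j ≠ 0 :=
  Finset.prod_ne_zero_iff.2 fun l _ => sub_ne_zero.2 (hy.ne (Fin.succAbove_ne j l).symm)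

/-- The numerator of the partial fraction `∑ c i / (t - y i)`. -/
noncomputable def fracNum {m : ℕ} (y c : Fin (m + 1) → ℝ) (t : ℝ) : ℝ :=
  ∑ i, c i * ∏ l, (t - y (i.succAbove l))

theorem fracNum_node {m : ℕ} (y c : Fin (m + 1) → ℝ) (k : Fin (m + 1)) :
    fracNum y c (y k) = c k * nodeDeriv y k := by
  rw [fracNum, Finset.sum_eq_single k]
  · rfl
  · intro i _ hi
    obtain ⟨l, hl⟩ := Fin.exists_succAbove_eq hi.symm
    rw [Finset.prod_eq_zero (Finset.mem_univ l) (by rw [hl, sub_self]), mul_zero]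
  · simp

open Polynomial in
/-- The polynomial whose values are given by `fracNum`. -/
noncomputable def fracPoly {m : ℕ} (y c : Fin (m + 1) → ℝ) : ℝ[X] :=
  ∑ i, C (c i) * rootPoly fun l => y (i.succAbove l)

theorem eval_fracPoly {m : ℕ} (y c : Fin (m + 1) → ℝ) (t : ℝ) :
    (fracPoly y c).eval t = fracNum y c t := by
  simp [fracPoly, fracNum, Polynomial.eval_finsetSum, eval_rootPoly]

theorem degree_fracPoly_lt {m : ℕ} (y c : Fin (m + 1) → ℝ) :
    (fracPoly y c).degree < (m + 1 : ℕ) := by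
  refine lt_of_le_of_lt (Polynomial.degree_sum_le _ _) ?_
  rw [Finset.sup_lt_iff (by exact WithBot.bot_lt_coe _)]
  intro i _
  rw [← Polynomial.smul_eq_C_mul]
  refine lt_of_le_of_lt (Polynomial.degree_smul_le _ _) ?_
  rw [degree_rootPoly]
  exact_mod_cast Nat.lt_succ_self m

theorem coeff_fracPoly {m : ℕ} (y c : Fin (m + 1) → ℝ) :
    (fracPoly y c).coeff m = ∑ i, c i := by
  rw [fracPoly, Polynomial.finsetSum_coeff]
  refine Finset.sum_congr rfl fun i _ => ?_
  have h := (monic_rootPoly fun l => y (i.succAbove l)).coeff_natDegree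
  rw [natDegree_rootPoly] at h
  rw [Polynomial.coeff_C_mul, h, mul_one]

/-- Partial fraction expansion. -/
theorem eq_fracPoly {m : ℕ} {y : Fin (m + 1) → ℝ} (hy : Function.Injective y)
    {f : Polynomial ℝ} (hf : f.degree < (m + 1 : ℕ)) :
    f = fracPoly y fun i => f.eval (y i) / nodeDeriv y i := by
  refine Polynomial.eq_of_degrees_lt_of_eval_index_eq (s := Finset.univ) (v := y) hy.injOn
    (by simpa using hf) (by simpa using degree_fracPoly_lt _ _) fun k _ => ?_
  rw [eval_fracPoly, fracNum_node, div_mul_cancel₀ _ (nodeDeriv_ne_zero hy k)]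

/-- The residues of `s ∏ (t - z j) / ∏ (t - y i)`, where `w = (s, z)`. -/
noncomputable def residues {m : ℕ} (y w : Fin (m + 1) → ℝ) : Fin (m + 1) → ℝ :=
  fun i => w 0 * (∏ j : Fin m, (y i - w j.succ)) / nodeDeriv y i

theorem fracPoly_residues {m : ℕ} {y : Fin (m + 1) → ℝ} (hy : Function.Injective y)
    (w : Fin (m + 1) → ℝ) :
    fracPoly y (residues y w) = Polynomial.C (w 0) * rootPoly (Fin.tail w) := by
  have hd : (Polynomial.C (w 0) * rootPoly (Fin.tail w)).degree < (m + 1 : ℕ) := by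
    rw [← Polynomial.smul_eq_C_mul]
    refine lt_of_le_of_lt (Polynomial.degree_smul_le _ _) ?_
    rw [degree_rootPoly]
    exact_mod_cast Nat.lt_succ_self m
  rw [eq_fracPoly hy hd]
  simp only [Polynomial.eval_mul, Polynomial.eval_C, eval_rootPoly]
  rfl

theorem fracNum_residues {m : ℕ} {y : Fin (m + 1) → ℝ} (hy : Function.Injective y)
    (w : Fin (m + 1) → ℝ) (t : ℝ) :
    fracNum y (residues y w) t = w 0 * ∏ j : Fin m, (t - w j.succ) := by
  rw [← eval_fracPoly, fracPoly_residues hy, Polynomial.eval_mul, Polynomial.eval_C, eval_rootPoly]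
  rfl

theorem sum_residues {m : ℕ} {y : Fin (m + 1) → ℝ} (hy : Function.Injective y)
    (w : Fin (m + 1) → ℝ) : ∑ i, residues y w i = w 0 := by
  rw [← coeff_fracPoly y, fracPoly_residues hy, Polynomial.coeff_C_mul]
  have h := (monic_rootPoly (Fin.tail w)).coeff_natDegree
  rw [natDegree_rootPoly] at h
  rw [h, mul_one]

/-- The vector `(a, c)` with
`∏ (t - x i) / ∏ (t - y j) = t - a - ∑ c j / (t - y j)`. -/
noncomputable def secular {m : ℕ} (y : Fin (m + 1) → ℝ) (x : Fin (m + 2) → ℝ) : Fin (m + 2) → ℝ :=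
  Fin.cons (∑ i, x i - ∑ j, y j) fun j => - (∏ i, (y j - x i)) / nodeDeriv y j

/-- The zeroth entry of `secular` is chosen so that the two monic polynomials have equal root sums;
their difference is then interpolated at the nodes y. -/
theorem rootPoly_eq_sub_fracPoly {m : ℕ} {y : Fin (m + 1) → ℝ} (hy : Function.Injective y)
    (x : Fin (m + 2) → ℝ) :
    rootPoly x = rootPoly (Fin.cons (secular y x 0) y : Fin (m + 2) → ℝ)
      - fracPoly y (Fin.tail (secular y x)) := by
  have hd : (rootPoly (Fin.cons (secular y x 0) y : Fin (m + 2) → ℝ) - rootPoly x).degree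
      < (m + 1 : ℕ) := by
    apply degree_rootPoly_sub_lt_of_sum_eq
    rw [Fin.sum_univ_succ]
    simp [secular]
  have h := eq_fracPoly hy hd
  rw [eq_sub_iff_add_eq, ← eq_sub_iff_add_eq', h]
  congr 1
  funext j
  have h0 : ∏ i, (y j - (Fin.cons (secular y x 0) y : Fin (m + 2) → ℝ) i) = 0 :=
    Finset.prod_eq_zero (Finset.mem_univ j.succ) (by simp)
  rw [Polynomial.eval_sub, eval_rootPoly, eval_rootPoly, h0, zero_sub]
  rfl

theorem prod_sub_eq_secular {m : ℕ} {y : Fin (m + 1) → ℝ} (hy : Function.Injective y)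
    (x : Fin (m + 2) → ℝ) (t : ℝ) :
    ∏ i, (t - x i) = (t - secular y x 0) * ∏ j, (t - y j)
      - fracNum y (Fin.tail (secular y x)) t := by
  rw [← eval_rootPoly, rootPoly_eq_sub_fracPoly hy, Polynomial.eval_sub, eval_fracPoly,
    eval_rootPoly, Fin.prod_univ_succ]
  simp

/-! ### Sums of squares of the roots -/

open Polynomial in
theorem coeff_prod_one_sub {ι : Type*} (s : Finset ι) (x : ι → ℝ) :
    (∏ i ∈ s, (1 - C (x i) * X)).coeff 0 = 1 ∧
    (∏ i ∈ s, (1 - C (x i) * X)).coeff 1 = - ∑ i ∈ s, x i ∧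
    2 * (∏ i ∈ s, (1 - C (x i) * X)).coeff 2 = (∑ i ∈ s, x i) ^ 2 - ∑ i ∈ s, x i ^ 2 := by
  classical
  induction s using Finset.induction_on with
  | empty => simp [coeff_one]
  | insert i s hi ih =>
    obtain ⟨h0, h1, h2⟩ := ih
    rw [Finset.prod_insert hi, Finset.sum_insert hi, Finset.sum_insert hi]
    have e : ∀ p : ℝ[X], (1 - C (x i) * X) * p = p - C (x i) * (X * p) := fun p => by ring
    simp only [e, coeff_sub, coeff_C_mul, coeff_X_mul, coeff_X_mul_zero, h0, h1]
    refine ⟨by ring, by ring, ?_⟩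
    linear_combination h2

-- This is tr T² = α² + 2s + tr T'² with s = ∑ c, where T' is the submatrix. It is read off the
-- coefficient of X² after reversing the polynomials in `rootPoly_eq_sub_fracPoly`.
open Polynomial in
theorem sum_sq_secular {m : ℕ} {y : Fin (m + 1) → ℝ} (hy : Function.Injective y)
    (x : Fin (m + 2) → ℝ) :
    ∑ i, x i ^ 2 = secular y x 0 ^ 2 + 2 * ∑ j, Fin.tail (secular y x) j + ∑ j, y j ^ 2 := by
  set a := secular y x 0
  set c := Fin.tail (secular y x)
  set v : Fin (m + 2) → ℝ := Fin.cons a y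
  have hpoly : ∏ i, (1 - C (x i) * X) = ∏ i, (1 - C (v i) * X)
      - X ^ 2 * ∑ j, C (c j) * ∏ l, (1 - C (y (j.succAbove l)) * X) := by
    refine Polynomial.eq_of_infinite_eval_eq _ _
      (Set.Infinite.mono ?_ (Set.Ioi_infinite (0 : ℝ)))
    intro t ht
    have ht0 : t ≠ 0 := ht.ne'
    -- Reversal by t ↦ 1/t. The numerators of the fractions have m factors against m + 2 elsewhere,
    -- which leaves the factor X².
    have hr : ∀ {n : ℕ} (u : Fin n → ℝ), ∏ i, (1 - u i * t) = t ^ n * ∏ i, (t⁻¹ - u i) := by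
      intro n u
      have : t ^ n = ∏ _i : Fin n, t := by simp
      rw [this, ← Finset.prod_mul_distrib]
      refine Finset.prod_congr rfl fun i _ => ?_
      field_simp
    have h := congrArg (Polynomial.eval t⁻¹) (rootPoly_eq_sub_fracPoly hy x)
    rw [Polynomial.eval_sub, eval_rootPoly, eval_rootPoly, eval_fracPoly, fracNum] at h
    simp only [Set.mem_ofPred_eq, eval_prod, eval_sub, eval_one, eval_mul, eval_C, eval_X, eval_pow,
      eval_finsetSum]
    simp only [hr, h]
    rw [mul_sub, Finset.mul_sum, Finset.mul_sum]
    congr 1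
    refine Finset.sum_congr rfl fun j _ => ?_
    ring
  obtain ⟨-, hx1, hx2⟩ := coeff_prod_one_sub Finset.univ x
  obtain ⟨-, hv1, hv2⟩ := coeff_prod_one_sub Finset.univ v
  have e1 := congrArg (fun p => coeff p 1) hpoly
  have e2 := congrArg (fun p => coeff p 2) hpoly
  have hc : (X ^ 2 * ∑ j, C (c j) * ∏ l, (1 - C (y (j.succAbove l)) * X)).coeff 2
      = ∑ j, c j := by
    rw [coeff_X_pow_mul' , if_pos le_rfl, Nat.sub_self, finsetSum_coeff]
    refine Finset.sum_congr rfl fun j _ => ?_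
    rw [coeff_C_mul, (coeff_prod_one_sub _ _).1, mul_one]
  have hc1 : (X ^ 2 * ∑ j, C (c j) * ∏ l, (1 - C (y (j.succAbove l)) * X)).coeff 1 = 0 := by
    rw [coeff_X_pow_mul', if_neg (by norm_num)]
  simp only [coeff_sub, hc, hc1, hx1, hv1] at e1 e2
  have hv : ∑ i, v i ^ 2 = a ^ 2 + ∑ j, y j ^ 2 := by
    rw [Fin.sum_univ_succ]; simp [v]
  have e3 : ∑ i, x i = ∑ i, v i := by linarith
  rw [e3] at hx2
  linarith

/-! ### Interlacing -/

theorem interlaced.strictAnti_fst {m : ℕ} {x : Fin (m + 1) → ℝ} {y : Fin m → ℝ}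
    (h : (x, y) ∈ interlaced m) : StrictAnti x :=
  Fin.strictAnti_iff_succ_lt.2 fun i => (h i).2.trans (h i).1

theorem interlaced.lt_of_le {m : ℕ} {x : Fin (m + 1) → ℝ} {y : Fin m → ℝ}
    (h : (x, y) ∈ interlaced m) {i : Fin (m + 1)} {j : Fin m} (hij : (i : ℕ) ≤ j) : y j < x i :=
  (h j).1.trans_le ((interlaced.strictAnti_fst h).antitone (by simpa [Fin.le_def] using hij))

theorem interlaced.lt_of_lt {m : ℕ} {x : Fin (m + 1) → ℝ} {y : Fin m → ℝ}
    (h : (x, y) ∈ interlaced m) {i : Fin (m + 1)} {j : Fin m} (hij : (j : ℕ) < i) : x i < y j :=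
  ((interlaced.strictAnti_fst h).antitone (by simpa [Fin.le_def] using hij)).trans_lt (h j).2

theorem interlaced.strictAnti_snd {m : ℕ} {x : Fin (m + 1) → ℝ} {y : Fin m → ℝ}
    (h : (x, y) ∈ interlaced m) : StrictAnti y := fun _ j hij =>
  (interlaced.lt_of_le h (i := j.castSucc) le_rfl).trans (interlaced.lt_of_lt h hij)

theorem interlaced.ne {m : ℕ} {x : Fin (m + 1) → ℝ} {y : Fin m → ℝ}
    (h : (x, y) ∈ interlaced m) (i : Fin (m + 1)) (j : Fin m) : x i ≠ y j := by
  obtain hij | hij := le_or_gt (i : ℕ) j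
  · exact (interlaced.lt_of_le h hij).ne'
  · exact (interlaced.lt_of_lt h hij).ne

/-- Exactly i of the factors are negative. All positivity of residues and all sign changes come from
this count. -/
theorem prod_sub_sign {n : ℕ} {u : Fin n → ℝ} {t : ℝ} {i : ℕ} (hi : i ≤ n)
    (h1 : ∀ l : Fin n, (l : ℕ) < i → t < u l) (h2 : ∀ l : Fin n, i ≤ l → u l < t) :
    0 < (-1) ^ i * ∏ l, (t - u l) := by
  have hc : (-1 : ℝ) ^ i = ∏ l : Fin n, if (l : ℕ) < i then (-1) else 1 := by
    rw [Finset.prod_ite]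
    simp [Fin.card_filter_val_lt, hi]
  rw [hc, ← Finset.prod_mul_distrib]
  refine Finset.prod_pos fun l _ => ?_
  split_ifs with h
  · linarith [h1 l h]
  · linarith [h2 l (not_lt.1 h)]

theorem nodeDeriv_sign {m : ℕ} {y : Fin (m + 1) → ℝ} (hy : StrictAnti y) (j : Fin (m + 1)) :
    0 < (-1) ^ (j : ℕ) * nodeDeriv y j := by
  refine prod_sub_sign (Nat.lt_succ_iff.1 j.2) (fun l hl => hy ?_) (fun l hl => hy ?_)
  · rw [Fin.succAbove_of_castSucc_lt _ _ (by simpa [Fin.lt_def] using hl)]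
    simpa [Fin.lt_def] using hl
  · rw [Fin.succAbove_of_le_castSucc _ _ (by simpa [Fin.le_def] using hl)]
    simp only [Fin.lt_def, Fin.val_succ]; omega

theorem fracNum_sign {m : ℕ} {y c : Fin (m + 1) → ℝ} (hy : StrictAnti y) (hc : ∀ i, 0 < c i)
    (j : Fin (m + 1)) : 0 < (-1) ^ (j : ℕ) * fracNum y c (y j) := by
  rw [fracNum_node]
  nlinarith [mul_pos (hc j) (nodeDeriv_sign hy j)]

theorem residues_pos {m : ℕ} {y w : Fin (m + 1) → ℝ} (hw : 0 < w 0)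
    (h : (y, Fin.tail w) ∈ interlaced m) (i : Fin (m + 1)) : 0 < residues y w i := by
  have h1 := nodeDeriv_sign (interlaced.strictAnti_fst h) i
  have h2 : 0 < (-1) ^ (i : ℕ) * ∏ j : Fin m, (y i - w j.succ) :=
    prod_sub_sign (Nat.lt_succ_iff.1 i.2) (fun l hl => interlaced.lt_of_lt h hl)
      (fun l hl => interlaced.lt_of_le h hl)
  have h3 := mul_pos hw (div_pos h2 h1)
  rwa [mul_div_mul_left _ _ (by simp), ← mul_div_assoc] at h3

theorem secular_pos {m : ℕ} {y : Fin (m + 1) → ℝ} {x : Fin (m + 2) → ℝ}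
    (h : (x, y) ∈ interlaced (m + 1)) (j : Fin (m + 1)) : 0 < secular y x j.succ := by
  have h1 := nodeDeriv_sign (interlaced.strictAnti_snd h) j
  have h2 : 0 < (-1) ^ ((j : ℕ) + 1) * ∏ i, (y j - x i) :=
    prod_sub_sign (by omega) (fun l hl => interlaced.lt_of_le h (by omega))
      (fun l hl => interlaced.lt_of_lt h hl)
  have h3 := div_pos h2 h1
  rw [pow_succ, mul_assoc, mul_div_mul_left _ _ (by simp), neg_one_mul] at h3
  exact h3

theorem exists_root_of_sign {f : ℝ → ℝ} (hf : Continuous f) {p q e : ℝ} (hpq : p < q)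
    (hp : e * f p < 0) (hq : 0 < e * f q) : ∃ r, p < r ∧ r < q ∧ f r = 0 := by
  obtain ⟨r, hr, h⟩ := intermediate_value_Ioo hpq.le (continuous_const.mul hf).continuousOn
    (Set.mem_Ioo.2 ⟨hp, hq⟩)
  refine ⟨r, hr.1, hr.2, (mul_eq_zero.1 h).resolve_left ?_⟩
  rintro rfl
  simp at hp

theorem exists_interlaced_roots_inner {m : ℕ} {y : Fin (m + 1) → ℝ} (hy : StrictAnti y)
    {f : ℝ → ℝ} (hf : Continuous f) (h : ∀ i : Fin (m + 1), 0 < (-1) ^ (i : ℕ) * f (y i)) :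
    ∃ z : Fin m → ℝ, (y, z) ∈ interlaced m ∧ ∀ j, f (z j) = 0 := by
  have : ∀ j : Fin m, ∃ r, y j.succ < r ∧ r < y j.castSucc ∧ f r = 0 := by
    intro j
    refine exists_root_of_sign hf (e := (-1) ^ (j : ℕ)) (hy Fin.castSucc_lt_succ) ?_
      (by simpa using h j.castSucc)
    have := h j.succ
    rw [Fin.val_succ, pow_succ] at this
    linarith
  choose z hz using this
  exact ⟨z, fun j => ⟨(hz j).2.1, (hz j).1⟩, fun j => (hz j).2.2⟩

theorem exists_interlaced_roots_outer {m : ℕ} {y : Fin (m + 1) → ℝ} (hy : StrictAnti y)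
    {f : ℝ → ℝ} (hf : Continuous f) (h : ∀ i : Fin (m + 1), (-1) ^ (i : ℕ) * f (y i) < 0)
    {p q : ℝ} (hp : p < y (Fin.last m)) (hfp : 0 < (-1) ^ m * f p) (hq : y 0 < q)
    (hfq : 0 < f q) :
    ∃ x : Fin (m + 2) → ℝ, (x, y) ∈ interlaced (m + 1) ∧ ∀ i, f (x i) = 0 := by
  -- The two bounds are conditional because the largest root has no node above it and the smallest
  -- none below; there `q` and `p` take the place of the missing node.
  have : ∀ i : Fin (m + 2), ∃ r, (∀ j, i = j.castSucc → y j < r) ∧ (∀ j, i = j.succ → r < y j)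
      ∧ f r = 0 := by
    intro i
    induction i using Fin.cases with
    | zero =>
      obtain ⟨r, h1, h2, h3⟩ := exists_root_of_sign hf (e := 1) hq (by simpa using h 0)
        (by simpa using hfq)
      refine ⟨r, fun j hj => ?_, fun j hj => absurd hj (Fin.succ_ne_zero j).symm, h3⟩
      rwa [show j = 0 from Fin.castSucc_injective _ (by rw [← hj]; rfl)]
    | succ k =>
      induction k using Fin.lastCases with
      | last =>
        obtain ⟨r, h1, h2, h3⟩ := exists_root_of_sign hf (e := -(-1) ^ m) hp (by linarith)
          (by have := h (Fin.last m); rw [Fin.val_last] at this; linarith)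
        refine ⟨r, fun j hj => ?_, fun j hj => ?_, h3⟩
        · have := congrArg Fin.val hj
          simp at this; omega
        · rwa [← Fin.succ_injective _ hj]
      | cast l =>
        obtain ⟨r, h1, h2, h3⟩ := exists_root_of_sign hf (e := -(-1) ^ (l : ℕ))
          (hy (Fin.castSucc_lt_succ (i := l)))
          (by have := h l.succ; rw [Fin.val_succ, pow_succ] at this; linarith)
          (by have := h l.castSucc; rw [Fin.val_castSucc] at this; linarith)
        refine ⟨r, fun j hj => ?_, fun j hj => ?_, h3⟩
        · rw [Fin.succ_castSucc] at hj
          rwa [← Fin.castSucc_injective _ hj]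
        · rwa [← Fin.succ_injective _ hj]
  choose x hx using this
  exact ⟨x, fun j => ⟨(hx _).1 j rfl, (hx _).2.1 j rfl⟩, fun i => (hx i).2.2⟩

theorem continuous_fracNum {m : ℕ} (y c : Fin (m + 1) → ℝ) : Continuous (fracNum y c) := by
  unfold fracNum
  fun_prop

/-! ### Bijectivity of the two coordinate changes. -/

theorem image_residues {m : ℕ} {y : Fin (m + 1) → ℝ} (hy : StrictAnti y) :
    residues y '' {w | 0 < w 0 ∧ (y, Fin.tail w) ∈ interlaced m} = {c | ∀ i, 0 < c i} := by
  ext c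
  constructor
  · rintro ⟨w, ⟨hw, h⟩, rfl⟩ i
    exact residues_pos hw h i
  · intro hc
    obtain ⟨z, hz, hz0⟩ := exists_interlaced_roots_inner hy (continuous_fracNum y c)
      (fracNum_sign hy hc)
    have hz' := interlaced.strictAnti_snd hz
    -- Both sides have degree at most m and the same coefficient there, and both vanish at the m
    -- points z.
    have hp : fracPoly y c = Polynomial.C (∑ i, c i) * rootPoly z := by
      refine Polynomial.eq_of_degree_sub_lt_of_eval_index_eq (s := Finset.univ) (v := z)
        hz'.injective.injOn ?_ fun j _ => ?_
      · rw [Polynomial.degree_lt_iff_coeff_zero]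
        intro k hk
        rw [Finset.card_univ, Fintype.card_fin] at hk
        have h1 := (monic_rootPoly z).coeff_natDegree
        rw [natDegree_rootPoly] at h1
        obtain rfl | hk := hk.eq_or_lt
        · rw [Polynomial.coeff_sub, coeff_fracPoly, Polynomial.coeff_C_mul, h1]; ring
        · rw [Polynomial.coeff_sub, Polynomial.coeff_C_mul,
            Polynomial.coeff_eq_zero_of_natDegree_lt (p := rootPoly z)
              (by rwa [natDegree_rootPoly]),
            Polynomial.coeff_eq_zero_of_degree_lt ((degree_fracPoly_lt y c).trans_le _)]
          · simp
          · exact_mod_cast hk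
      · rw [eval_fracPoly, hz0, Polynomial.eval_mul, eval_rootPoly,
          Finset.prod_eq_zero (Finset.mem_univ j) (sub_self _), mul_zero]
    refine ⟨Fin.cons (∑ i, c i) z, ⟨?_, by simpa using hz⟩, ?_⟩
    · exact Finset.sum_pos (fun i _ => hc i) Finset.univ_nonempty
    · funext k
      have h1 := congrArg (Polynomial.eval (y k)) hp
      rw [eval_fracPoly, fracNum_node, Polynomial.eval_mul, Polynomial.eval_C, eval_rootPoly] at h1
      simp only [residues, Fin.cons_zero, Fin.cons_succ]
      rw [← h1, mul_div_cancel_right₀ _ (nodeDeriv_ne_zero hy.injective k)]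

/-- The residues sum to s, and after division by s > 0 their numerator is the monic polynomial with
roots z. -/
theorem injOn_residues {m : ℕ} {y : Fin (m + 1) → ℝ} (hy : StrictAnti y) :
    Set.InjOn (residues y) {w | 0 < w 0 ∧ (y, Fin.tail w) ∈ interlaced m} := by
  rintro w ⟨hw, h⟩ w' ⟨hw', h'⟩ heq
  have h0 : w 0 = w' 0 := by rw [← sum_residues hy.injective w, heq, sum_residues hy.injective]
  have ht : Fin.tail w = Fin.tail w' := by
    refine eq_of_rootValues_eq (interlaced.strictAnti_snd h).antitone
      (interlaced.strictAnti_snd h').antitone ?_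
    funext t
    have h1 := fracNum_residues hy.injective w t
    rw [heq, fracNum_residues hy.injective, h0] at h1
    exact (mul_left_cancel₀ hw'.ne' h1).symm
  rw [← Fin.cons_self_tail w, ← Fin.cons_self_tail w', h0, ht]

/-- The ordered roots of `(t - a) ∏ (t - y j) - ∑ c j ∏ (t - y l)`, where `v = (a, c)`. -/
noncomputable def secularRoots {m : ℕ} (y : Fin (m + 1) → ℝ) (v : Fin (m + 2) → ℝ) :
    Fin (m + 2) → ℝ :=
  rootsOfValues _ fun t => ((t : ℝ) - v 0) * rootValues y t - fracNum y (Fin.tail v) t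

theorem measurable_secularRoots (m : ℕ) : Measurable
    fun p : (Fin (m + 1) → ℝ) × (Fin (m + 2) → ℝ) => secularRoots p.1 p.2 := by
  refine (measurable_rootsOfValues _).comp (measurable_pi_lambda _ fun t => ?_)
  simp only [rootValues, fracNum, Fin.tail]
  fun_prop

theorem secularRoots_secular {m : ℕ} {y : Fin (m + 1) → ℝ} {x : Fin (m + 2) → ℝ}
    (h : (x, y) ∈ interlaced (m + 1)) : secularRoots y (secular y x) = x := by
  conv_rhs => rw [← rootsOfValues_rootValues (interlaced.strictAnti_fst h).antitone]
  rw [secularRoots]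
  congr 1
  funext t
  exact (prod_sub_eq_secular (interlaced.strictAnti_snd h).injective x t).symm

theorem injOn_secular {m : ℕ} (y : Fin (m + 1) → ℝ) :
    Set.InjOn (secular y) {x | (x, y) ∈ interlaced (m + 1)} := by
  intro x hx x' hx' h
  rw [← secularRoots_secular hx, h, secularRoots_secular hx']

theorem extend_eq_secularRoots {m : ℕ} {y : Fin (m + 1) → ℝ} (hy : Function.Injective y)
    (w : Fin (m + 1) → ℝ) (a : ℝ) :
    extend y (Fin.tail w) a (w 0) = secularRoots y (Fin.cons a (residues y w)) := by
  rw [extend, secularRoots]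
  congr 1
  funext t
  rw [Fin.tail_cons, fracNum_residues hy]
  rfl

theorem abs_fracNum_le {m : ℕ} {y c : Fin (m + 1) → ℝ} (hc : ∀ i, 0 < c i) {t : ℝ}
    (ht : ∀ i, 1 ≤ |t - y i|) : |fracNum y c t| ≤ (∑ i, c i) * |∏ i, (t - y i)| := by
  rw [fracNum, Finset.sum_mul]
  refine (Finset.abs_sum_le_sum_abs _ _).trans (Finset.sum_le_sum fun i _ => ?_)
  rw [abs_mul, abs_of_pos (hc i), Fin.prod_univ_succAbove _ i, abs_mul]
  exact mul_le_mul_of_nonneg_left (le_mul_of_one_le_left (abs_nonneg _) (ht i)) (hc i).le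

theorem image_secular {m : ℕ} {y : Fin (m + 1) → ℝ} (hy : StrictAnti y) :
    secular y '' {x | (x, y) ∈ interlaced (m + 1)} = {v | ∀ j : Fin (m + 1), 0 < v j.succ} := by
  ext v
  constructor
  · rintro ⟨x, h, rfl⟩ j
    exact secular_pos h j
  · intro hv
    set a := v 0
    set c := Fin.tail v
    have hc : ∀ i, 0 < c i := hv
    set f : ℝ → ℝ := fun t => (t - a) * ∏ j, (t - y j) - fracNum y c t with hf
    have hfc : Continuous f := by
      have := continuous_fracNum y c
      fun_prop
    have hy0 : ∀ i, y i ≤ y 0 := fun i => hy.antitone (Fin.zero_le i)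
    have hyl : ∀ i, y (Fin.last m) ≤ y i := fun i => hy.antitone (Fin.le_last i)
    have hfy : ∀ i, f (y i) = - fracNum y c (y i) := fun i => by
      rw [hf]; simp only
      rw [Finset.prod_eq_zero (Finset.mem_univ i) (sub_self _)]; ring
    set S := ∑ i, c i with hS
    -- The points `p` and `q` lie at distance at least 1 from every node and more than `S` from `a`.
    -- By `abs_fracNum_le` the term (t - a) ∏ (t - y_j) then dominates `fracNum`, which fixes the
    -- sign of `f` beyond the nodes.
    obtain ⟨q, hq1, hq2⟩ : ∃ q, y 0 + 1 ≤ q ∧ a + S < q :=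
      ⟨max (y 0 + 1) (a + S + 1), le_max_left _ _, (lt_add_one _).trans_le (le_max_right _ _)⟩
    obtain ⟨p, hp1, hp2⟩ : ∃ p, p ≤ y (Fin.last m) - 1 ∧ p < a - S :=
      ⟨min (y (Fin.last m) - 1) (a - S - 1), min_le_left _ _,
        (min_le_right _ _).trans_lt (sub_one_lt _)⟩
    have hq3 := abs_fracNum_le (y := y) hc (t := q) fun i => by
      rw [abs_of_nonneg] <;> linarith [hy0 i]
    have hp3 := abs_fracNum_le (y := y) hc (t := p) fun i => by
      rw [abs_of_nonpos] <;> linarith [hyl i]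
    have hq4 : 0 < ∏ i, (q - y i) := Finset.prod_pos fun i _ => by linarith [hy0 i]
    have hp4 : 0 < (-1) ^ (m + 1) * ∏ i, (p - y i) :=
      prod_sub_sign le_rfl (fun l _ => by linarith [hyl l]) fun l hl => by omega
    obtain ⟨x, hx, hx0⟩ := exists_interlaced_roots_outer (f := f) hy hfc
      (fun i => by rw [hfy]; linarith [fracNum_sign hy hc i]) (p := p) (q := q) (by linarith)
      (by
        have e1 : |∏ i, (p - y i)| = (-1) ^ (m + 1) * ∏ i, (p - y i) := by
          rw [← abs_of_pos hp4, abs_mul, abs_pow, abs_neg, abs_one, one_pow, one_mul]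
        have e2 : (-1) ^ m * fracNum y c p ≤ |fracNum y c p| := by
          refine (le_abs_self _).trans ?_
          rw [abs_mul, abs_pow, abs_neg, abs_one, one_pow, one_mul]
        rw [e1] at hp3
        simp only [hf, pow_succ] at hp3 hp4 ⊢
        nlinarith)
      (by linarith)
      (by
        rw [abs_of_pos hq4] at hq3
        simp only [hf]
        nlinarith [le_abs_self (fracNum y c q)])
    have hx' := interlaced.strictAnti_fst hx
    have hp : rootPoly (Fin.cons a y : Fin (m + 2) → ℝ) - fracPoly y c = rootPoly x := by
      refine Polynomial.eq_of_degree_sub_lt_of_eval_index_eq (s := Finset.univ) (v := x)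
        hx'.injective.injOn ?_ fun i _ => ?_
      · rw [sub_right_comm, Finset.card_univ, Fintype.card_fin]
        refine lt_of_le_of_lt (Polynomial.degree_sub_le _ _)
          (max_lt (degree_rootPoly_sub_lt _ _) ((degree_fracPoly_lt y c).trans ?_))
        exact_mod_cast Nat.lt_succ_self _
      · rw [Polynomial.eval_sub, eval_fracPoly, eval_rootPoly, eval_rootPoly,
          Finset.prod_eq_zero (f := fun k => x i - x k) (Finset.mem_univ i) (sub_self _),
          Fin.prod_univ_succ, ← hx0 i]
        simp [hf]
    refine ⟨x, hx, ?_⟩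
    rw [← Fin.cons_self_tail v, secular]
    congr 1
    -- The entry `a` is recovered from the second highest coefficient, the entries `c` from the
    -- values at the nodes.
    · have h1 := congrArg (fun P => Polynomial.coeff P (m + 1)) hp
      simp only [Polynomial.coeff_sub, nextCoeff_rootPoly] at h1
      rw [Polynomial.coeff_eq_zero_of_degree_lt (degree_fracPoly_lt y c), Fin.sum_univ_succ] at h1
      simp only [Fin.cons_zero, Fin.cons_succ] at h1
      change _ = a
      linarith
    · funext j
      have h1 := congrArg (Polynomial.eval (y j)) hp
      rw [Polynomial.eval_sub, eval_fracPoly, fracNum_node, eval_rootPoly, eval_rootPoly,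
        Finset.prod_eq_zero (Finset.mem_univ j.succ) (by simp)] at h1
      rw [← h1, zero_sub, neg_neg, mul_div_cancel_right₀ _ (nodeDeriv_ne_zero hy.injective j)]

/-! ### The bordered Cauchy determinant -/

theorem abs_det_vandermonde {n : ℕ} (x : Fin n → ℝ) :
    |(Matrix.vandermonde x).det| = absVandermonde x := by
  simp only [Matrix.det_vandermonde, Finset.abs_prod, absVandermonde]

theorem absVandermonde_cons {n : ℕ} (t : ℝ) (y : Fin n → ℝ) :
    absVandermonde (Fin.cons t y : Fin (n + 1) → ℝ) = (∏ j, |y j - t|) * absVandermonde y := by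
  simp only [absVandermonde, Fin.prod_univ_succ, Fin.prod_Ioi_zero, Fin.prod_Ioi_succ,
    Fin.cons_zero, Fin.cons_succ]

theorem absVandermonde_nonneg {n : ℕ} (x : Fin n → ℝ) : 0 ≤ absVandermonde x :=
  Finset.prod_nonneg fun _ _ => Finset.prod_nonneg fun _ _ => abs_nonneg _

theorem absVandermonde_pos {n : ℕ} {x : Fin n → ℝ} (hx : Function.Injective x) :
    0 < absVandermonde x :=
  Finset.prod_pos fun _ _ => Finset.prod_pos fun _ hj =>
    abs_pos.2 (sub_ne_zero.2 (hx.ne (Finset.mem_Ioi.1 hj).ne'))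

/-- Each unordered pair of nodes contributes twice. -/
theorem prod_abs_nodeDeriv {m : ℕ} (y : Fin (m + 1) → ℝ) :
    ∏ j, |nodeDeriv y j| = absVandermonde y ^ 2 := by
  have h1 : ∀ j, |nodeDeriv y j|
      = (∏ l ∈ Finset.Ioi j, |y l - y j|) * ∏ l ∈ Finset.Iio j, |y j - y l| := by
    intro j
    have e : (Finset.univ.erase j) = Finset.univ.map (Fin.succAboveEmb j) := by
      rw [Fin.univ_succAbove m j, Finset.erase_cons]
    have e2 : Finset.univ.erase j = (Finset.Ioi j).disjUnion (Finset.Iio j)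
        (Finset.disjoint_left.2 fun a ha hb => by
          rw [Finset.mem_Ioi] at ha; rw [Finset.mem_Iio] at hb; exact lt_asymm ha hb) := by
      ext l; simp [lt_or_lt_iff_ne, ne_comm]
    have e3 : |nodeDeriv y j| = ∏ l ∈ Finset.univ.erase j, |y j - y l| := by
      rw [e, Finset.prod_map, nodeDeriv, Finset.abs_prod]; rfl
    rw [e3, e2, Finset.prod_disjUnion]
    congr 1
    exact Finset.prod_congr rfl fun l _ => abs_sub_comm _ _
  simp only [h1, Finset.prod_mul_distrib, sq]
  congr 1
  rw [absVandermonde]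
  exact Finset.prod_comm' (by simp)

/-- The Cauchy matrix `1 / (x i - y j)` bordered by a column of ones. -/
noncomputable def borderedCauchy {n : ℕ} (x : Fin (n + 1) → ℝ) (y : Fin n → ℝ) :
    Matrix (Fin (n + 1)) (Fin (n + 1)) ℝ :=
  Matrix.of fun i => Fin.cons 1 fun j => 1 / (x i - y j)

/-- Multiplying row i by ∏ (x_i - y_j) turns the entries into values at x_i of fixed polynomials, so
the matrix becomes Vandermonde(x) times a coefficient matrix `M` independent of x. Taking the points
t, y in place of x makes the product triangular, which gives |det M| = V(y). -/
theorem abs_det_borderedCauchy_succ {n : ℕ} {x : Fin (n + 2) → ℝ} {y : Fin (n + 1) → ℝ}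
    (hy : Function.Injective y) (hxy : ∀ i j, x i ≠ y j) :
    |(borderedCauchy x y).det|
      = absVandermonde x * absVandermonde y / ∏ i, ∏ j, |x i - y j| := by
  set q : Fin (n + 2) → Polynomial ℝ :=
    Fin.cons (rootPoly y) fun j => rootPoly fun l => y (j.succAbove l)
  have hq : ∀ k, (q k).natDegree < n + 2 := by
    intro k
    induction k using Fin.cases with
    | zero => simp [q, natDegree_rootPoly]
    | succ j => simp [q, natDegree_rootPoly]
  set M : Matrix (Fin (n + 2)) (Fin (n + 2)) ℝ := Matrix.of fun i k => (q k).coeff i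
  have hM : ∀ u : Fin (n + 2) → ℝ,
      Matrix.of (fun i k => (q k).eval (u i)) = Matrix.vandermonde u * M := by
    intro u
    ext i k
    rw [Matrix.of_apply, Polynomial.eval_eq_sum_range' (hq k), Matrix.mul_apply,
      ← Fin.sum_univ_eq_sum_range (fun e => (q k).coeff e * u i ^ e)]
    simp [Matrix.vandermonde_apply, M, mul_comm]
  -- the determinant of `M` is found by evaluation at the nodes and one more point
  obtain ⟨t, ht⟩ : ∃ t, ∀ j, y j < t := by
    obtain ⟨B, hB⟩ := (Set.finite_range y).bddAbove
    exact ⟨B + 1, fun j => (hB ⟨j, rfl⟩).trans_lt (lt_add_one _)⟩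
  have hdetM : |M.det| = absVandermonde y := by
    have h1 := congrArg (fun A => |Matrix.det A|) (hM (Fin.cons t y))
    simp only [Matrix.det_mul, abs_mul, abs_det_vandermonde, absVandermonde_cons] at h1
    have htri : (Matrix.of fun i k =>
        (q k).eval ((Fin.cons t y : Fin (n + 2) → ℝ) i)).BlockTriangular id := by
      intro i k hik
      simp only [id] at hik
      induction i using Fin.cases with
      | zero => exact absurd hik (Fin.not_lt_zero k)
      | succ i =>
        induction k using Fin.cases with
        | zero =>
          simp only [Matrix.of_apply, q, Fin.cons_succ, Fin.cons_zero, eval_rootPoly]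
          exact Finset.prod_eq_zero (Finset.mem_univ i) (sub_self _)
        | succ k =>
          simp only [Matrix.of_apply, q, Fin.cons_succ, eval_rootPoly]
          obtain ⟨l, hl⟩ := Fin.exists_succAbove_eq (Fin.succ_lt_succ_iff.1 hik).ne'
          exact Finset.prod_eq_zero (Finset.mem_univ l) (by rw [hl, sub_self])
    rw [Matrix.det_of_isUpperTriangular htri, Fin.prod_univ_succ, abs_mul, Finset.abs_prod] at h1
    simp only [Matrix.of_apply, q, Fin.cons_succ, Fin.cons_zero, eval_rootPoly] at h1
    have h2 : ∏ j, |∏ l, (y j - y (j.succAbove l))| = absVandermonde y ^ 2 :=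
      prod_abs_nodeDeriv y
    rw [h2, Finset.abs_prod] at h1
    have h3 : ∏ j, |y j - t| = ∏ j, |t - y j| :=
      Finset.prod_congr rfl fun j _ => abs_sub_comm _ _
    rw [h3] at h1
    have h4 : 0 < ∏ j, |t - y j| := Finset.prod_pos fun j _ => abs_pos.2 (by linarith [ht j])
    have h5 := absVandermonde_pos hy
    have h6 := mul_pos h4 h5
    refine mul_left_cancel₀ h6.ne' ?_
    rw [← h1]; ring
  have h1 := congrArg (fun A => |Matrix.det A|) (hM x)
  simp only [Matrix.det_mul, abs_mul, abs_det_vandermonde, hdetM] at h1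
  have hne : ∀ i, ∏ j, (x i - y j) ≠ 0 := fun i =>
    Finset.prod_ne_zero_iff.2 fun j _ => sub_ne_zero.2 (hxy i j)
  have h2 : (Matrix.of fun i k => (q k).eval (x i))
      = Matrix.diagonal (fun i => ∏ j, (x i - y j)) * borderedCauchy x y := by
    ext i k
    rw [Matrix.diagonal_mul, borderedCauchy, Matrix.of_apply, Matrix.of_apply]
    induction k using Fin.cases with
    | zero => simp [q, eval_rootPoly]
    | succ j =>
      simp only [q, Fin.cons_succ, eval_rootPoly]
      rw [Fin.prod_univ_succAbove _ j]
      have := sub_ne_zero.2 (hxy i j)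
      field_simp
  rw [h2, Matrix.det_mul, Matrix.det_diagonal, abs_mul, Finset.abs_prod] at h1
  simp only [Finset.abs_prod] at h1
  rw [eq_div_iff, ← h1, mul_comm]
  exact Finset.prod_ne_zero_iff.2 fun i _ => by
    rw [← Finset.abs_prod]; exact abs_ne_zero.2 (hne i)

theorem abs_det_borderedCauchy {n : ℕ} {x : Fin (n + 1) → ℝ} {y : Fin n → ℝ}
    (hy : Function.Injective y) (hxy : ∀ i j, x i ≠ y j) :
    |(borderedCauchy x y).det|
      = absVandermonde x * absVandermonde y / ∏ i, ∏ j, |x i - y j| := by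
  cases n with
  | zero => simp [borderedCauchy, absVandermonde]
  | succ n => exact abs_det_borderedCauchy_succ hy hxy

/-! ### Changes of variables -/

/-- Logarithmic differentiation, in a form covering the entries of `residues` and the product
entries of `secular`. It exhibits their Jacobians as rescaled bordered Cauchy matrices. -/
theorem hasFDerivAt_prod_affine {n : ℕ} (α ε : Fin n → ℝ) (κ : ℝ) {w : Fin n → ℝ}
    (hw : ∀ k, α k + ε k * w k ≠ 0) :
    HasFDerivAt (fun w : Fin n → ℝ => (∏ k, (α k + ε k * w k)) * κ)
      (∑ k, (((∏ k, (α k + ε k * w k)) * κ) * (ε k / (α k + ε k * w k))) •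
        (ContinuousLinearMap.proj k : (Fin n → ℝ) →L[ℝ] ℝ)) w := by
  have h1 : ∀ k, HasFDerivAt (fun w : Fin n → ℝ => α k + ε k * w k)
      (ε k • (ContinuousLinearMap.proj k : (Fin n → ℝ) →L[ℝ] ℝ)) w := fun k =>
    ((hasFDerivAt_apply k w).const_mul (ε k)).const_add (α k)
  have h2 := (HasFDerivAt.finsetProd (u := Finset.univ) fun k _ => h1 k).mul_const κ
  refine h2.congr_fderiv ?_
  rw [Finset.smul_sum]
  refine Finset.sum_congr rfl fun k _ => ?_
  rw [← Finset.mul_prod_erase _ _ (Finset.mem_univ k), smul_smul, smul_smul]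
  congr 1
  have := hw k
  field_simp

theorem hasFDerivAt_of_rows {n : ℕ} {f : (Fin n → ℝ) → (Fin n → ℝ)} {w : Fin n → ℝ}
    {J : Matrix (Fin n) (Fin n) ℝ}
    (h : ∀ i, HasFDerivAt (fun w => f w i)
      (∑ k, J i k • (ContinuousLinearMap.proj k : (Fin n → ℝ) →L[ℝ] ℝ)) w) :
    HasFDerivAt f (Matrix.toLin' J).toContinuousLinearMap w := by
  rw [hasFDerivAt_pi']
  intro i
  refine (h i).congr_fderiv ?_
  ext v
  simp [Matrix.mulVec, dotProduct]

/-- The Jacobian matrix of `residues y`. -/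
noncomputable def residuesJacobian {m : ℕ} (y w : Fin (m + 1) → ℝ) :
    Matrix (Fin (m + 1)) (Fin (m + 1)) ℝ :=
  Matrix.diagonal (residues y w) * borderedCauchy y (Fin.tail w)
    * Matrix.diagonal (Fin.cons (1 / w 0) fun _ => -1)

theorem hasFDerivAt_residues {m : ℕ} {y w : Fin (m + 1) → ℝ} (hw : w 0 ≠ 0)
    (h : ∀ i (j : Fin m), y i ≠ w j.succ) :
    HasFDerivAt (residues y) (Matrix.toLin' (residuesJacobian y w)).toContinuousLinearMap w := by
  refine hasFDerivAt_of_rows fun i => ?_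
  have h1 := hasFDerivAt_prod_affine (Fin.cons 0 fun _ => y i) (Fin.cons 1 fun _ => -1)
    (1 / nodeDeriv y i) (w := w) fun k => by
      induction k using Fin.cases with
      | zero => simpa using hw
      | succ j => simpa [← sub_eq_add_neg, sub_ne_zero] using h i j
  have h2 : ∀ w : Fin (m + 1) → ℝ, (∏ k, ((Fin.cons 0 (fun _ => y i) : Fin (m + 1) → ℝ) k
      + (Fin.cons 1 (fun _ => -1) : Fin (m + 1) → ℝ) k * w k)) * (1 / nodeDeriv y i)
      = residues y w i := by
    intro w
    rw [Fin.prod_univ_succ, residues]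
    simp [← sub_eq_add_neg, div_eq_mul_inv]
  simp only [h2] at h1
  refine h1.congr_fderiv (Finset.sum_congr rfl fun k _ => ?_)
  congr 1
  rw [residuesJacobian, Matrix.mul_diagonal, Matrix.diagonal_mul, borderedCauchy]
  induction k using Fin.cases with
  | zero => simp
  | succ j =>
    simp only [Matrix.of_apply, Fin.cons_succ, Fin.tail]
    ring

theorem prod_residues {m : ℕ} {y w : Fin (m + 1) → ℝ} (hw : 0 < w 0)
    (h : (y, Fin.tail w) ∈ interlaced m) :
    ∏ i, residues y w i = w 0 ^ (m + 1) * (∏ i, ∏ j, |y i - Fin.tail w j|)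
      / absVandermonde y ^ 2 := by
  have h1 : ∀ i, residues y w i
      = w 0 * (∏ j, |y i - Fin.tail w j|) / |nodeDeriv y i| := by
    intro i
    rw [← abs_of_pos (residues_pos hw h i), residues, abs_div, abs_mul, abs_of_pos hw,
      Finset.abs_prod]
    rfl
  simp only [h1]
  rw [Finset.prod_div_distrib, Finset.prod_mul_distrib, prod_abs_nodeDeriv]
  simp

theorem prod_secular {m : ℕ} {y : Fin (m + 1) → ℝ} {x : Fin (m + 2) → ℝ}
    (h : (x, y) ∈ interlaced (m + 1)) :
    ∏ j : Fin (m + 1), secular y x j.succ = (∏ i, ∏ j, |x i - y j|) / absVandermonde y ^ 2 := by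
  have h1 : ∀ j : Fin (m + 1), secular y x j.succ = (∏ i, |x i - y j|) / |nodeDeriv y j| := by
    intro j
    rw [← abs_of_pos (secular_pos h j), secular, Fin.cons_succ, abs_div, abs_neg,
      Finset.abs_prod]
    simp only [abs_sub_comm]
  simp only [h1]
  rw [Finset.prod_div_distrib, prod_abs_nodeDeriv, Finset.prod_comm]

theorem prod_abs_sub_pos {n : ℕ} {x : Fin (n + 1) → ℝ} {y : Fin n → ℝ}
    (h : (x, y) ∈ interlaced n) : 0 < ∏ i, ∏ j, |x i - y j| :=
  Finset.prod_pos fun i _ => Finset.prod_pos fun j _ =>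
    abs_pos.2 (sub_ne_zero.2 (interlaced.ne h i j))

/-- The product of the residues supplies s^(m+1) ∏ |y_i - z_j| / V(y)². Its double product cancels
the denominator of the Cauchy determinant, and the column scaling removes one power of s. -/
theorem abs_det_residuesJacobian {m : ℕ} {y w : Fin (m + 1) → ℝ} (hw : 0 < w 0)
    (h : (y, Fin.tail w) ∈ interlaced m) :
    |(residuesJacobian y w).det|
      = w 0 ^ m * absVandermonde (Fin.tail w) / absVandermonde y := by
  have h2 := prod_abs_sub_pos h
  have h3 := absVandermonde_pos (interlaced.strictAnti_fst h).injective
  have h4 : |∏ k, (Fin.cons (1 / w 0) (fun _ => -1) : Fin (m + 1) → ℝ) k| = 1 / w 0 := by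
    rw [Fin.prod_univ_succ, abs_mul, Finset.abs_prod]
    simp [abs_of_pos hw]
  rw [residuesJacobian, Matrix.det_mul, Matrix.det_mul, Matrix.det_diagonal, Matrix.det_diagonal,
    abs_mul, abs_mul, abs_det_borderedCauchy (interlaced.strictAnti_snd h).injective
      (interlaced.ne h), abs_of_pos (Finset.prod_pos fun i _ => residues_pos hw h i),
    prod_residues hw h, h4]
  field_simp
  ring

/-- The Jacobian matrix of `secular y`. -/
noncomputable def secularJacobian {m : ℕ} (y : Fin (m + 1) → ℝ) (x : Fin (m + 2) → ℝ) :
    Matrix (Fin (m + 2)) (Fin (m + 2)) ℝ :=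
  Matrix.diagonal (Fin.cons 1 fun j => secular y x j.succ) * (borderedCauchy x y).transpose

theorem hasFDerivAt_secular {m : ℕ} {y : Fin (m + 1) → ℝ} {x : Fin (m + 2) → ℝ}
    (h : ∀ i j, x i ≠ y j) :
    HasFDerivAt (secular y) (Matrix.toLin' (secularJacobian y x)).toContinuousLinearMap x := by
  refine hasFDerivAt_of_rows fun i => ?_
  induction i using Fin.cases with
  | zero =>
    have h1 : HasFDerivAt (fun x : Fin (m + 2) → ℝ => ∑ i, x i - ∑ j, y j)
        (∑ k, (ContinuousLinearMap.proj k : (Fin (m + 2) → ℝ) →L[ℝ] ℝ)) x :=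
      (HasFDerivAt.fun_sum fun k _ => hasFDerivAt_apply k x).sub_const _
    refine h1.congr_fderiv (Finset.sum_congr rfl fun k _ => ?_)
    simp [secularJacobian, Matrix.diagonal_mul, borderedCauchy]
  | succ j =>
    have h1 := hasFDerivAt_prod_affine (fun _ => y j) (fun _ => -1)
      (-1 / nodeDeriv y j) (w := x) fun k => by
        simpa [← sub_eq_add_neg, sub_ne_zero] using (h k j).symm
    have h2 : ∀ x : Fin (m + 2) → ℝ, (∏ k, (y j + -1 * x k)) * (-1 / nodeDeriv y j)
        = secular y x j.succ := by
      intro x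
      simp [secular, ← sub_eq_add_neg, div_eq_mul_inv]
    simp only [h2] at h1
    refine h1.congr_fderiv (Finset.sum_congr rfl fun k _ => ?_)
    congr 1
    rw [secularJacobian, Matrix.diagonal_mul, borderedCauchy]
    simp only [Matrix.of_apply, Fin.cons_succ, Matrix.transpose_apply]
    rw [← neg_sub (y j) (x k), one_div_neg_eq_neg_one_div]
    ring

theorem abs_det_secularJacobian {m : ℕ} {y : Fin (m + 1) → ℝ} {x : Fin (m + 2) → ℝ}
    (h : (x, y) ∈ interlaced (m + 1)) :
    |(secularJacobian y x).det| = absVandermonde x / absVandermonde y := by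
  have h2 := prod_abs_sub_pos h
  have h3 := absVandermonde_pos (interlaced.strictAnti_snd h).injective
  rw [secularJacobian, Matrix.det_mul, Matrix.det_transpose, Matrix.det_diagonal, abs_mul,
    abs_det_borderedCauchy (interlaced.strictAnti_snd h).injective (interlaced.ne h),
    Fin.prod_univ_succ]
  simp only [Fin.cons_zero, Fin.cons_succ, one_mul]
  rw [abs_of_pos (Finset.prod_pos fun i _ => secular_pos h i), prod_secular h]
  field_simp

theorem measurableSet_interlaced (m : ℕ) : MeasurableSet (interlaced m) := by
  simp only [interlaced, Set.ofPred_forall]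
  refine MeasurableSet.iInter fun i => MeasurableSet.inter ?_ ?_
  · exact measurableSet_lt (f := fun p : (Fin (m + 1) → ℝ) × (Fin m → ℝ) => p.2 i)
      (g := fun p => p.1 i.castSucc) (by fun_prop) (by fun_prop)
  · exact measurableSet_lt (f := fun p : (Fin (m + 1) → ℝ) × (Fin m → ℝ) => p.1 i.succ)
      (g := fun p => p.2 i) (by fun_prop) (by fun_prop)

theorem measurableSet_residues_domain {m : ℕ} (y : Fin (m + 1) → ℝ) :
    MeasurableSet {w : Fin (m + 1) → ℝ | 0 < w 0 ∧ (y, Fin.tail w) ∈ interlaced m} := by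
  refine MeasurableSet.inter (measurableSet_lt measurable_const (measurable_pi_apply 0)) ?_
  have h : Measurable fun w : Fin (m + 1) → ℝ => (y, Fin.tail w) := by
    unfold Fin.tail
    fun_prop
  exact h (measurableSet_interlaced m)

theorem lintegral_residues {m : ℕ} {y : Fin (m + 1) → ℝ} (hy : StrictAnti y)
    (g : (Fin (m + 1) → ℝ) → ENNReal) :
    ∫⁻ c in {c | ∀ i, 0 < c i}, g c
      = ∫⁻ w in {w : Fin (m + 1) → ℝ | 0 < w 0 ∧ (y, Fin.tail w) ∈ interlaced m},
        ENNReal.ofReal (w 0 ^ m * absVandermonde (Fin.tail w) / absVandermonde y)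
          * g (residues y w) := by
  rw [← image_residues hy, lintegral_image_eq_lintegral_abs_det_fderiv_mul volume
    (measurableSet_residues_domain y) (fun w hw => (hasFDerivAt_residues hw.1.ne' fun i j =>
      interlaced.ne hw.2 i j).hasFDerivWithinAt) (injOn_residues hy)]
  refine setLIntegral_congr_fun (measurableSet_residues_domain y) fun w hw => ?_
  simp only [ContinuousLinearMap.det, LinearMap.coe_toContinuousLinearMap, LinearMap.det_toLin']
  rw [abs_det_residuesJacobian hw.1 hw.2]

theorem lintegral_secular {m : ℕ} {y : Fin (m + 1) → ℝ} (hy : StrictAnti y)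
    (g : (Fin (m + 2) → ℝ) → ENNReal) :
    ∫⁻ v in {v : Fin (m + 2) → ℝ | ∀ j : Fin (m + 1), 0 < v j.succ}, g v
      = ∫⁻ x in {x | (x, y) ∈ interlaced (m + 1)},
        ENNReal.ofReal (absVandermonde x / absVandermonde y) * g (secular y x) := by
  have hm : MeasurableSet {x | (x, y) ∈ interlaced (m + 1)} :=
    (measurable_id.prodMk measurable_const) (measurableSet_interlaced (m + 1))
  rw [← image_secular hy, lintegral_image_eq_lintegral_abs_det_fderiv_mul volume hm
    (fun x hx => (hasFDerivAt_secular (interlaced.ne hx)).hasFDerivWithinAt) (injOn_secular y)]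
  refine setLIntegral_congr_fun hm fun x hx => ?_
  simp only [ContinuousLinearMap.det, LinearMap.coe_toContinuousLinearMap, LinearMap.det_toLin']
  rw [abs_det_secularJacobian hx]

/-! ### Integration over `Fin n → ℝ` -/

theorem lintegral_fin_succ {n : ℕ} {f : (Fin (n + 1) → ℝ) → ℝ≥0∞} (hf : Measurable f) :
    ∫⁻ w, f w = ∫⁻ t, ∫⁻ v : Fin n → ℝ, f (Fin.cons t v) := by
  have h := (volume_preserving_piFinSuccAbove (fun _ : Fin (n + 1) => ℝ) 0).symm
  rw [← h.lintegral_comp hf, Measure.volume_eq_prod, lintegral_prod _ (by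
    exact (hf.comp (MeasurableEquiv.measurable _)).aemeasurable)]
  refine lintegral_congr fun t => lintegral_congr fun v => congrArg f ?_
  exact Fin.insertNth_zero' t v

theorem lintegral_prod_const_apply {f : ℝ → ℝ≥0∞} (hf : Measurable f) (n : ℕ) :
    ∫⁻ v : Fin n → ℝ, ∏ i, f (v i) = (∫⁻ t, f t) ^ n := by
  induction n with
  | zero => simp [lintegral_unique, volume_pi]
  | succ n ih =>
    have hm : ∀ n, Measurable fun v : Fin n → ℝ => ∏ i, f (v i) := fun n => by fun_prop
    rw [lintegral_fin_succ (hm _)]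
    simp only [Fin.prod_univ_succ, Fin.cons_zero, Fin.cons_succ]
    simp only [lintegral_const_mul _ (hm n), ih]
    rw [lintegral_mul_const _ hf, pow_succ, mul_comm]

theorem exists_perm_strictAnti {n : ℕ} {x : Fin n → ℝ} (hx : Function.Injective x) :
    ∃ σ : Equiv.Perm (Fin n), StrictAnti (x ∘ σ) := by
  refine ⟨Fin.revPerm.trans (Tuple.sort x), fun i j hij => ?_⟩
  have h := (Tuple.monotone_sort x).strictMono_of_injective
    (hx.comp (Tuple.sort x).injective)
  exact h (Fin.rev_lt_rev.2 hij)

theorem eq_of_strictAnti_comp {n : ℕ} {x : Fin n → ℝ} {σ τ : Equiv.Perm (Fin n)}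
    (hσ : StrictAnti (x ∘ σ)) (hτ : StrictAnti (x ∘ τ)) : σ = τ := by
  have hx : Function.Injective x := by
    have := hσ.injective.comp σ.symm.injective
    rwa [Function.comp_assoc, Equiv.self_comp_symm, Function.comp_id] at this
  have h : x ∘ σ ∘ Fin.rev = x ∘ τ ∘ Fin.rev := by
    refine (StrictMono.range_inj (f := x ∘ σ ∘ Fin.rev) (g := x ∘ τ ∘ Fin.rev)
      (fun i j hij => hσ (Fin.rev_lt_rev.2 hij)) (fun i j hij => hτ (Fin.rev_lt_rev.2 hij))).1 ?_
    rw [(σ.surjective.comp Fin.rev_surjective).range_comp x,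
      (τ.surjective.comp Fin.rev_surjective).range_comp x]
  ext i
  have := hx (congrFun h (Fin.rev i))
  simpa using congrArg Fin.val this

theorem measurableSet_strictAnti (n : ℕ) : MeasurableSet {x : Fin n → ℝ | StrictAnti x} := by
  simp only [StrictAnti, Set.ofPred_forall]
  refine MeasurableSet.iInter fun i => MeasurableSet.iInter fun j => MeasurableSet.iInter fun _ => ?_
  exact measurableSet_lt (measurable_pi_apply j) (measurable_pi_apply i)

/-- Each vector without ties lies in exactly one of the n! ordering chambers, and permuting
coordinates preserves volume. Since f vanishes at ties, the decomposition holds pointwise. -/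
theorem lintegral_eq_factorial_mul {n : ℕ} {f : (Fin n → ℝ) → ℝ≥0∞} (hf : Measurable f)
    (hsymm : ∀ (σ : Equiv.Perm (Fin n)) x, f (x ∘ σ) = f x)
    (h0 : ∀ x, ¬ Function.Injective x → f x = 0) :
    ∫⁻ x, f x = n ! * ∫⁻ x in {x | StrictAnti x}, f x := by
  set g := {x : Fin n → ℝ | StrictAnti x}.indicator f
  have hg : Measurable g := hf.indicator (measurableSet_strictAnti n)
  have h1 : ∀ x, f x = ∑ σ : Equiv.Perm (Fin n), g (x ∘ σ) := by
    intro x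
    by_cases hx : Function.Injective x
    · obtain ⟨σ, hσ⟩ := exists_perm_strictAnti hx
      rw [Finset.sum_eq_single σ]
      · simp only [g]
        rw [Set.indicator_of_mem (by exact hσ), hsymm]
      · intro τ _ hτ
        exact Set.indicator_of_notMem (fun h => hτ (eq_of_strictAnti_comp h hσ)) _
      · simp
    · rw [h0 x hx, Finset.sum_eq_zero]
      intro σ _
      by_cases h : x ∘ σ ∈ {x : Fin n → ℝ | StrictAnti x}
      · simp only [g]
        rw [Set.indicator_of_mem h, hsymm, h0 x hx]
      · exact Set.indicator_of_notMem h _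
  have h2 : ∀ σ : Equiv.Perm (Fin n), ∫⁻ x, g (x ∘ σ) = ∫⁻ x, g x := by
    intro σ
    have h := volume_measurePreserving_piCongrLeft (fun _ : Fin n => ℝ) σ.symm
    rw [← h.lintegral_comp hg]
    refine lintegral_congr fun x => congrArg g ?_
    funext i
    rw [MeasurableEquiv.coe_piCongrLeft]
    have h3 := Equiv.piCongrLeft_apply_apply (fun _ : Fin n => ℝ) σ.symm x (σ i)
    rw [Equiv.symm_apply_apply] at h3
    rw [h3]; rfl
  have hσ : ∀ σ : Equiv.Perm (Fin n), Measurable fun x : Fin n → ℝ => g (x ∘ σ) := fun σ =>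
    hg.comp (measurable_pi_lambda _ fun i => measurable_pi_apply (σ i))
  simp_rw [h1]
  rw [lintegral_finsetSum _ fun σ _ => hσ σ]
  simp only [h2, Finset.sum_const, Finset.card_univ, Fintype.card_perm, Fintype.card_fin,
    nsmul_eq_mul]
  simp_rw [← h1]
  rw [lintegral_indicator (measurableSet_strictAnti n)]

/-! ### The Mehta integral -/

theorem continuous_absVandermonde (n : ℕ) : Continuous (absVandermonde (n := n)) := by
  unfold absVandermonde
  fun_prop

theorem absVandermonde_comp_perm {n : ℕ} (x : Fin n → ℝ) (σ : Equiv.Perm (Fin n)) :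
    absVandermonde (x ∘ σ) = absVandermonde x := by
  rw [← abs_det_vandermonde, ← abs_det_vandermonde]
  have h : Matrix.vandermonde (x ∘ σ) = (Matrix.vandermonde x).submatrix σ id := rfl
  rw [h, Matrix.det_permute, abs_mul]
  obtain h | h := Int.units_eq_one_or (Equiv.Perm.sign σ) <;> simp [h]

theorem absVandermonde_eq_zero {n : ℕ} {x : Fin n → ℝ} (hx : ¬ Function.Injective x) :
    absVandermonde x = 0 := by
  rw [← abs_det_vandermonde, abs_eq_zero, Matrix.det_vandermonde_eq_zero_iff]
  simpa [Function.Injective] using hx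

/-- The unnormalized eigenvalue density. -/
noncomputable def betaWeight {n : ℕ} (k c : ℝ) (x : Fin n → ℝ) : ℝ :=
  Real.exp (-c * ∑ l, x l ^ 2) * absVandermonde x ^ (2 * k)

theorem betaWeight_nonneg {n : ℕ} (k c : ℝ) (x : Fin n → ℝ) : 0 ≤ betaWeight k c x :=
  mul_nonneg (Real.exp_nonneg _) (Real.rpow_nonneg (absVandermonde_nonneg x) _)

theorem measurable_betaWeight {n : ℕ} (k c : ℝ) : Measurable (betaWeight (n := n) k c) := by
  unfold betaWeight
  have := (continuous_absVandermonde n).measurable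
  fun_prop

theorem mehtaIntegral_eq {n : ℕ} {k : ℝ} (hk : 0 < k) (c : ℝ) :
    mehtaIntegral n k (2 * c)
      = n ! * (∫⁻ x : Fin n → ℝ in {x | StrictAnti x}, ENNReal.ofReal (betaWeight k c x)).toReal := by
  have h : mehtaIntegral n k (2 * c) = ∫ x : Fin n → ℝ, betaWeight k c x := by
    unfold mehtaIntegral betaWeight
    congr 1
    funext x
    congr 2
    ring
  rw [h, integral_eq_lintegral_of_nonneg_ae (Filter.Eventually.of_forall (betaWeight_nonneg k c))
    (measurable_betaWeight k c).aestronglyMeasurable, lintegral_eq_factorial_mul]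
  · simp
  · exact (measurable_betaWeight k c).ennreal_ofReal
  · intro σ x
    rw [betaWeight, absVandermonde_comp_perm, betaWeight]
    congr 4
    exact Equiv.sum_comp σ fun i => x i ^ 2
  · intro x hx
    rw [betaWeight, absVandermonde_eq_zero hx, Real.zero_rpow (by positivity)]
    simp

theorem eq_factorial_div_mehtaIntegral {n : ℕ} {k : ℝ} (hk : 0 < k) {c C : ℝ} (hC : 0 ≤ C)
    (h : ∫⁻ x : Fin n → ℝ in {x | StrictAnti x}, ENNReal.ofReal (C * betaWeight k c x) = 1) :
    C = n ! / mehtaIntegral n k (2 * c) := by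
  simp only [ENNReal.ofReal_mul hC] at h
  rw [lintegral_const_mul _ (measurable_betaWeight k c).ennreal_ofReal] at h
  have h1 := congrArg ENNReal.toReal h
  rw [ENNReal.toReal_mul, ENNReal.toReal_ofReal hC, ENNReal.toReal_one] at h1
  rw [mehtaIntegral_eq hk]
  have h2 : (n ! : ℝ) ≠ 0 := by positivity
  -- This also excludes divergence: an infinite integral would have `toReal` equal to 0.
  have h3 := right_ne_zero_of_mul_eq_one h1
  field_simp
  linarith

/-! ### The gamma density -/

/-- The gamma density on the open half-line. -/
noncomputable def gammaDensity (s r t : ℝ) : ℝ :=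
  (Set.Ioi 0).indicator (fun t => r ^ s / Real.Gamma s * t ^ (s - 1) * Real.exp (-(r * t))) t

theorem measurable_gammaDensity (s r : ℝ) : Measurable (gammaDensity s r) := by
  refine Measurable.indicator ?_ measurableSet_Ioi
  fun_prop

theorem gammaDensity_of_pos {s r t : ℝ} (ht : 0 < t) :
    gammaDensity s r t = r ^ s / Real.Gamma s * t ^ (s - 1) * Real.exp (-(r * t)) :=
  Set.indicator_of_mem (s := Set.Ioi (0 : ℝ)) ht _

theorem gammaDensity_of_nonpos {s r t : ℝ} (ht : t ≤ 0) : gammaDensity s r t = 0 :=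
  Set.indicator_of_notMem (s := Set.Ioi (0 : ℝ)) (not_lt.2 ht) _

theorem gammaDensity_nonneg {s r : ℝ} (hs : 0 < s) (hr : 0 < r) (t : ℝ) :
    0 ≤ gammaDensity s r t := by
  obtain ht | ht := le_or_gt t 0
  · rw [gammaDensity_of_nonpos ht]
  · rw [gammaDensity_of_pos ht]
    have := Real.Gamma_pos_of_pos hs
    positivity

/-- Only the value at 0 may differ. With the open half-line, products of densities are supported
exactly on the image of `residues`. -/
theorem gammaPDF_ae_eq (s r : ℝ) :
    gammaPDF s r =ᵐ[volume] fun t => ENNReal.ofReal (gammaDensity s r t) := by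
  filter_upwards [Measure.ae_ne volume (0 : ℝ)] with t ht
  obtain ht | ht := lt_or_gt_of_ne ht
  · rw [gammaPDF_of_neg ht, gammaDensity_of_nonpos ht.le, ENNReal.ofReal_zero]
  · rw [gammaPDF_of_nonneg ht.le, gammaDensity_of_pos ht]

theorem gammaMeasure_eq (s r : ℝ) :
    gammaMeasure s r = volume.withDensity fun t => ENNReal.ofReal (gammaDensity s r t) :=
  withDensity_congr_ae (gammaPDF_ae_eq s r)

theorem lintegral_gammaDensity {s r : ℝ} (hs : 0 < s) (hr : 0 < r) :
    ∫⁻ t, ENNReal.ofReal (gammaDensity s r t) = 1 := by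
  rw [← lintegral_congr_ae (gammaPDF_ae_eq s r), lintegral_gammaPDF_eq_one hs hr]

theorem prod_gammaDensity_eq_indicator {n : ℕ} (s r : ℝ) (v : Fin n → ℝ) :
    ∏ i, gammaDensity s r (v i)
      = {v : Fin n → ℝ | ∀ i, 0 < v i}.indicator (fun v => ∏ i, gammaDensity s r (v i)) v := by
  by_cases hv : ∀ i, 0 < v i
  · rw [Set.indicator_of_mem (by exact hv)]
  · rw [Set.indicator_of_notMem (by exact hv)]
    push Not at hv
    obtain ⟨i, hi⟩ := hv
    exact Finset.prod_eq_zero (Finset.mem_univ i) (gammaDensity_of_nonpos hi)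

theorem measurableSet_forall_pos (n : ℕ) : MeasurableSet {v : Fin n → ℝ | ∀ i, 0 < v i} := by
  simp only [Set.ofPred_forall]
  exact MeasurableSet.iInter fun i => measurableSet_lt measurable_const (measurable_pi_apply i)

theorem lintegral_prod_gammaDensity {s r : ℝ} (hs : 0 < s) (hr : 0 < r) (n : ℕ) :
    ∫⁻ v in {v : Fin n → ℝ | ∀ i, 0 < v i}, ENNReal.ofReal (∏ i, gammaDensity s r (v i)) = 1 := by
  have h : ∫⁻ v : Fin n → ℝ, ENNReal.ofReal (∏ i, gammaDensity s r (v i)) = 1 := by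
    simp only [ENNReal.ofReal_prod_of_nonneg fun i _ => gammaDensity_nonneg hs hr _]
    rw [lintegral_prod_const_apply (f := fun t => ENNReal.ofReal (gammaDensity s r t))
      (measurable_gammaDensity s r).ennreal_ofReal, lintegral_gammaDensity hs hr, one_pow]
  rw [← lintegral_indicator (measurableSet_forall_pos n), ← h]
  refine lintegral_congr fun v => ?_
  rw [prod_gammaDensity_eq_indicator]
  by_cases hv : v ∈ {v : Fin n → ℝ | ∀ i, 0 < v i}
  · rw [Set.indicator_of_mem hv, Set.indicator_of_mem hv]
  · rw [Set.indicator_of_notMem hv, Set.indicator_of_notMem hv, ENNReal.ofReal_zero]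

/-! ### Identities between densities -/

/-- The constant of the eigenvalue density of the matrix of size `m + 1`, in terms of the constant of
the density of its spectrum together with that of its bottom right submatrix. -/
noncomputable def betaConst (m : ℕ) (k c : ℝ) : ℝ :=
  Real.sqrt (c / Real.pi) * ((2 * c) ^ ((m : ℝ) * k) / Real.Gamma k ^ m)
    * ((m ! : ℝ) / mehtaIntegral m k (2 * c))
    * (Real.Gamma k ^ (m + 1) / Real.Gamma (((m : ℝ) + 1) * k))

theorem mehtaIntegral_nonneg (n : ℕ) (k c : ℝ) : 0 ≤ mehtaIntegral n k c :=
  integral_nonneg fun x =>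
    mul_nonneg (Real.exp_nonneg _) (Real.rpow_nonneg (absVandermonde_nonneg x) _)

theorem betaConst_nonneg {m : ℕ} {k c : ℝ} (hk : 0 < k) (hc : 0 < c) : 0 ≤ betaConst m k c := by
  have h1 := mehtaIntegral_nonneg m k (2 * c)
  have h2 := Real.Gamma_pos_of_pos hk
  have h3 : 0 < Real.Gamma (((m : ℝ) + 1) * k) := Real.Gamma_pos_of_pos (by positivity)
  unfold betaConst
  positivity

theorem prod_gammaDensity {n : ℕ} (s r : ℝ) {v : Fin n → ℝ} (hv : ∀ i, 0 < v i) :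
    ∏ i, gammaDensity s r (v i)
      = (r ^ s / Real.Gamma s) ^ n * (∏ i, v i) ^ (s - 1) * Real.exp (-(r * ∑ i, v i)) := by
  simp only [gammaDensity_of_pos (hv _)]
  rw [Finset.prod_mul_distrib, Finset.prod_mul_distrib, ← Real.exp_sum,
    Real.finsetProd_rpow _ _ fun i _ => (hv i).le, Finset.mul_sum, Finset.sum_neg_distrib,
    Finset.prod_const, Finset.card_univ, Fintype.card_fin]

theorem prod_rpow_abs_sub {n : ℕ} (x : Fin (n + 1) → ℝ) (y : Fin n → ℝ) (s : ℝ) :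
    ∏ i, ∏ j, |x i - y j| ^ s = (∏ i, ∏ j, |x i - y j|) ^ s := by
  rw [← Real.finsetProd_rpow _ _ fun i _ => Finset.prod_nonneg fun j _ => abs_nonneg _]
  exact Finset.prod_congr rfl fun i _ => Real.finsetProd_rpow _ _ (fun j _ => abs_nonneg _) s

theorem prod_exp_mul_sq {n : ℕ} (a : ℝ) (x : Fin n → ℝ) :
    ∏ i, Real.exp (-a * x i ^ 2) = Real.exp (-a * ∑ i, x i ^ 2) := by
  rw [← Real.exp_sum, Finset.mul_sum]

/-- Given y, the residues are independent Gamma(k) variables. Their sum s matches the exponentials;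
s^((m+1)k-1) splits into the Jacobian factor s^m and the power (s^(m+1))^(k-1) from the product of
the residues. The powers of the rate `2 * a` agree, so `betaConst` does not depend on it. -/
theorem gammaDensity_mul_interlacedPDF {m : ℕ} {k a c : ℝ} (hk : 0 < k) (ha : 0 < a)
    {y w : Fin (m + 1) → ℝ} (hw : 0 < w 0) (h : (y, Fin.tail w) ∈ interlaced m) :
    gammaDensity (((m : ℝ) + 1) * k) (2 * a) (w 0) * interlacedPDF m k c 0 (y, Fin.tail w)
      = (w 0 ^ m * absVandermonde (Fin.tail w) / absVandermonde y)
        * (betaConst m k c * betaWeight k c y * ∏ i, gammaDensity k (2 * a) (residues y w i)) := by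
  have hy := absVandermonde_pos (interlaced.strictAnti_fst h).injective
  have hP := prod_abs_sub_pos h
  have hG := (Real.Gamma_pos_of_pos hk).ne'
  have hG' : Real.Gamma (((m : ℝ) + 1) * k) ≠ 0 := (Real.Gamma_pos_of_pos (by positivity)).ne'
  rw [prod_gammaDensity k (2 * a) (residues_pos hw h), prod_residues hw h,
    sum_residues (interlaced.strictAnti_fst h).injective, gammaDensity_of_pos hw, interlacedPDF,
    Set.indicator_of_mem h]
  simp only [prod_rpow_abs_sub, prod_exp_mul_sq, betaWeight, betaConst]
  generalize hPd : ∏ i, ∏ j, |y i - Fin.tail w j| = P at *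
  generalize absVandermonde y = D at *
  generalize absVandermonde (Fin.tail w) = E at *
  generalize w 0 = s at *
  have e1 : s ^ (((m : ℝ) + 1) * k - 1) = s ^ m * (s ^ (m + 1)) ^ (k - 1) := by
    rw [← Real.rpow_natCast s m, ← Real.rpow_natCast s (m + 1), ← Real.rpow_mul hw.le,
      ← Real.rpow_add hw]
    congr 1
    push_cast
    ring
  have e2 : D ^ (2 * k) = D * D * (D ^ 2) ^ (k - 1) := by
    rw [← Real.rpow_natCast D 2, ← Real.rpow_mul hy.le, ← sq, ← Real.rpow_natCast D 2,
      ← Real.rpow_add hy]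
    congr 1
    push_cast
    ring
  have e3 : (2 * a) ^ (((m : ℝ) + 1) * k) = ((2 * a) ^ k) ^ (m + 1) := by
    rw [← Real.rpow_natCast _ (m + 1), ← Real.rpow_mul (by positivity)]
    congr 1
    push_cast
    ring
  have e4 : (s ^ (m + 1) * P / D ^ 2) ^ (k - 1)
      = (s ^ (m + 1)) ^ (k - 1) * P ^ (k - 1) / (D ^ 2) ^ (k - 1) := by
    rw [Real.div_rpow (by positivity) (by positivity), Real.mul_rpow (by positivity) hP.le]
  have hD2 : (D ^ 2) ^ (k - 1) ≠ 0 := (Real.rpow_pos_of_pos (by positivity) _).ne'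
  rw [e1, e2, e3, e4]
  simp only [add_zero, neg_zero, zero_mul, Real.exp_zero, mul_one, div_pow]
  generalize mehtaIntegral m k (2 * c) = M
  generalize (s ^ (m + 1)) ^ (k - 1) = S
  generalize (D ^ 2) ^ (k - 1) = F at *
  field_simp

theorem gaussianPDFReal_eq {a : ℝ} (ha : 0 < a) (t : ℝ) :
    gaussianPDFReal 0 (1 / (2 * a)).toNNReal t
      = Real.sqrt (a / Real.pi) * Real.exp (-a * t ^ 2) := by
  rw [gaussianPDFReal, Real.coe_toNNReal _ (by positivity), ← Real.sqrt_inv]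
  congr 2
  · field_simp
  · field_simp
    simp

/-- By `sum_sq_secular`, exp(-a ∑ x²) is the Gaussian factor in α, times the Gamma exponentials of
rate 2a, times exp(-a ∑ y²); the last merges with exp(-a₁ ∑ y²) into the weight with parameter a +
a₁. -/
theorem gaussianPDF_mul_prod_gammaDensity {m : ℕ} {k a a₁ : ℝ} (ha : 0 < a)
    (hC : betaConst m k (a + a₁) = (m + 1)! / mehtaIntegral (m + 1) k (2 * (a + a₁)))
    {y : Fin (m + 1) → ℝ} {x : Fin (m + 2) → ℝ} (h : (x, y) ∈ interlaced (m + 1)) :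
    (absVandermonde x / absVandermonde y) * (gaussianPDFReal 0 (1 / (2 * a)).toNNReal (secular y x 0)
        * (betaConst m k (a + a₁) * betaWeight k (a + a₁) y
          * ∏ j : Fin (m + 1), gammaDensity k (2 * a) (secular y x j.succ)))
      = interlacedPDF (m + 1) k a a₁ (x, y) := by
  have hy := absVandermonde_pos (interlaced.strictAnti_snd h).injective
  have hP := prod_abs_sub_pos h
  rw [prod_gammaDensity k (2 * a) (v := fun j : Fin (m + 1) => secular y x j.succ) (secular_pos h),
    prod_secular h, interlacedPDF, Set.indicator_of_mem h, gaussianPDFReal_eq ha, hC]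
  simp only [prod_rpow_abs_sub, prod_exp_mul_sq, betaWeight]
  rw [sum_sq_secular (interlaced.strictAnti_snd h).injective x]
  have e0 : ∑ j, Fin.tail (secular y x) j = ∑ j : Fin (m + 1), secular y x j.succ := rfl
  rw [e0]
  generalize ∑ j : Fin (m + 1), secular y x j.succ = c
  generalize secular y x 0 = t
  generalize ∑ i, y i ^ 2 = Y
  have e5 : Real.exp (-a * (t ^ 2 + 2 * c + Y)) * Real.exp (-a₁ * Y)
      = Real.exp (-a * t ^ 2) * Real.exp (-(a + a₁) * Y) * Real.exp (-(2 * a * c)) := by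
    rw [← Real.exp_add, ← Real.exp_add, ← Real.exp_add]
    congr 1
    ring
  generalize Real.exp (-a * (t ^ 2 + 2 * c + Y)) = E1 at *
  generalize Real.exp (-a₁ * Y) = E2 at *
  generalize Real.exp (-a * t ^ 2) = E3 at *
  generalize Real.exp (-(a + a₁) * Y) = E4 at *
  generalize Real.exp (-(2 * a * c)) = E5 at *
  generalize hPd : ∏ i, ∏ j, |x i - y j| = P at *
  generalize absVandermonde y = D at *
  generalize absVandermonde x = X at *
  have e2 : D ^ (2 * k) = D * D * (D ^ 2) ^ (k - 1) := by
    rw [← Real.rpow_natCast D 2, ← Real.rpow_mul hy.le, ← sq, ← Real.rpow_natCast D 2,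
      ← Real.rpow_add hy]
    congr 1
    push_cast
    ring
  have e3 : (2 * a) ^ (((m + 1 : ℕ) : ℝ) * k) = ((2 * a) ^ k) ^ (m + 1) := by
    rw [← Real.rpow_natCast _ (m + 1), ← Real.rpow_mul (by positivity)]
    congr 1
    push_cast
    ring
  have e4 : (P / D ^ 2) ^ (k - 1) = P ^ (k - 1) / (D ^ 2) ^ (k - 1) :=
    Real.div_rpow hP.le (by positivity) _
  have hD2 : (D ^ 2) ^ (k - 1) ≠ 0 := (Real.rpow_pos_of_pos (by positivity) _).ne'
  rw [e2, e3, e4, div_pow]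
  generalize (D ^ 2) ^ (k - 1) = F at *
  generalize P ^ (k - 1) = Q at *
  generalize ((m + 1)! : ℝ) / mehtaIntegral (m + 1) k (2 * (a + a₁)) = M
  generalize ((2 * a) ^ k) ^ (m + 1) / Real.Gamma k ^ (m + 1) = N
  generalize Real.sqrt (a / Real.pi) = R
  field_simp
  linear_combination (-(X * R * M * N * Q)) * e5

theorem betaWeight_mul_const_nonneg {m : ℕ} {k c : ℝ} (hk : 0 < k) (hc : 0 < c)
    (y : Fin (m + 1) → ℝ) : 0 ≤ betaConst m k c * betaWeight k c y :=
  mul_nonneg (betaConst_nonneg hk hc) (betaWeight_nonneg k c y)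

theorem measurable_interlacedPDF (m : ℕ) (k a a₁ : ℝ) : Measurable (interlacedPDF m k a a₁) := by
  refine Measurable.indicator ?_ (measurableSet_interlaced m)
  have h1 := (continuous_absVandermonde (m + 1)).measurable
  have h2 := (continuous_absVandermonde m).measurable
  fun_prop

theorem interlacedPDF_eq_zero {m : ℕ} (k a a₁ : ℝ) {y : Fin (m + 1) → ℝ} (hy : ¬ StrictAnti y)
    (z : Fin m → ℝ) : interlacedPDF m k a a₁ (y, z) = 0 :=
  Set.indicator_of_notMem (fun h => hy (interlaced.strictAnti_fst h)) _

/-- Integration of the smaller submatrix and of the new off-diagonal entry, in the coordinates given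
by the residues. -/
theorem lintegral_gammaDensity_mul_interlacedPDF {m : ℕ} {k a c : ℝ} (hk : 0 < k) (ha : 0 < a)
    {y : Fin (m + 1) → ℝ} (hy : StrictAnti y) (H : (Fin (m + 1) → ℝ) → ℝ≥0∞) :
    ∫⁻ w : Fin (m + 1) → ℝ, ENNReal.ofReal (gammaDensity (((m : ℝ) + 1) * k) (2 * a) (w 0)
        * interlacedPDF m k c 0 (y, Fin.tail w)) * H (residues y w)
      = ∫⁻ v in {v | ∀ i, 0 < v i}, ENNReal.ofReal (betaConst m k c * betaWeight k c y
          * ∏ i, gammaDensity k (2 * a) (v i)) * H v := by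
  rw [lintegral_residues hy, ← lintegral_indicator (measurableSet_residues_domain y)]
  refine lintegral_congr fun w => ?_
  by_cases hw : w ∈ {w : Fin (m + 1) → ℝ | 0 < w 0 ∧ (y, Fin.tail w) ∈ interlaced m}
  · have h0 := absVandermonde_nonneg (Fin.tail w)
    have h1 := absVandermonde_nonneg y
    rw [Set.indicator_of_mem hw, gammaDensity_mul_interlacedPDF hk ha hw.1 hw.2,
      ENNReal.ofReal_mul (by have := hw.1; positivity), mul_assoc]
  · rw [Set.indicator_of_notMem hw]
    simp only [Set.mem_ofPred_eq, not_and_or, not_lt] at hw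
    obtain hw | hw := hw
    · simp [gammaDensity_of_nonpos hw]
    · rw [interlacedPDF, Set.indicator_of_notMem hw]
      simp

/-! ### The law of the enlarged spectrum -/

/-- A Dixon–Anderson integral: an auxiliary Gamma variable s of mass one is adjoined, so that (s, z)
can be replaced by independent Gamma residues, which also have mass one. -/
theorem lintegral_interlacedPDF_snd {m : ℕ} {k c : ℝ} (hk : 0 < k) (hc : 0 < c)
    {y : Fin (m + 1) → ℝ} (hy : StrictAnti y) :
    ∫⁻ z, ENNReal.ofReal (interlacedPDF m k c 0 (y, z))
      = ENNReal.ofReal (betaConst m k c * betaWeight k c y) := by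
  have hs : 0 < ((m : ℝ) + 1) * k := by positivity
  have hρ : Measurable fun z => ENNReal.ofReal (interlacedPDF m k c 0 (y, z)) :=
    ((measurable_interlacedPDF m k c 0).comp measurable_prodMk_left).ennreal_ofReal
  have hγ := measurable_gammaDensity (((m : ℝ) + 1) * k) (2 * 1)
  -- The rate of the auxiliary variable is arbitrary; here it is 2.
  have h := lintegral_gammaDensity_mul_interlacedPDF hk one_pos (c := c) hy 1
  simp only [Pi.one_apply, mul_one] at h
  simp only [ENNReal.ofReal_mul (betaWeight_mul_const_nonneg hk hc y)] at h
  rw [lintegral_const_mul' _ _ ENNReal.ofReal_ne_top] at h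
  rw [mul_one] at hγ
  have h1 := lintegral_prod_gammaDensity hk (r := 2) two_pos (m + 1)
  rw [h1, mul_one] at h
  rw [← h, lintegral_fin_succ]
  · simp only [Fin.cons_zero, Fin.tail_cons, ENNReal.ofReal_mul (gammaDensity_nonneg hs two_pos _)]
    simp only [lintegral_const_mul' _ _ ENNReal.ofReal_ne_top]
    rw [lintegral_mul_const _ hγ.ennreal_ofReal, lintegral_gammaDensity hs two_pos, one_mul]
  · have h2 : Measurable fun w : Fin (m + 1) → ℝ => interlacedPDF m k c 0 (y, Fin.tail w) :=
      (measurable_interlacedPDF m k c 0).comp (measurable_const.prodMk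
        (measurable_pi_lambda _ fun j => measurable_pi_apply j.succ))
    have h3 := hγ.comp (measurable_pi_apply (X := fun _ : Fin (m + 1) => ℝ) 0)
    exact (h3.mul h2).ennreal_ofReal

theorem betaConst_eq {m : ℕ} {k c : ℝ} (hk : 0 < k) (hc : 0 < c)
    [IsProbabilityMeasure (interlacedEnsemble m k c 0)] :
    betaConst m k c = (m + 1)! / mehtaIntegral (m + 1) k (2 * c) := by
  refine eq_factorial_div_mehtaIntegral hk (betaConst_nonneg hk hc) ?_
  have h := measure_univ (μ := interlacedEnsemble m k c 0)
  rw [interlacedEnsemble, withDensity_apply _ MeasurableSet.univ, Measure.restrict_univ,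
    Measure.volume_eq_prod,
    lintegral_prod _ (measurable_interlacedPDF m k c 0).ennreal_ofReal.aemeasurable] at h
  rw [← h, ← lintegral_indicator (measurableSet_strictAnti _)]
  refine lintegral_congr fun y => ?_
  by_cases hy : StrictAnti y
  · rw [Set.indicator_of_mem (by exact hy), lintegral_interlacedPDF_snd hk hc hy]
  · rw [Set.indicator_of_notMem (by exact hy)]
    simp [interlacedPDF_eq_zero k c 0 hy]

theorem lintegral_prod_eq_lintegral_cons {n : ℕ} {Φ : (Fin n → ℝ) → ℝ × ℝ → ℝ≥0∞}
    (hΦ : Measurable (Function.uncurry Φ)) :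
    ∫⁻ z, ∫⁻ q, Φ z q = ∫⁻ t, ∫⁻ w : Fin (n + 1) → ℝ, Φ (Fin.tail w) (t, w 0) := by
  rw [lintegral_lintegral_swap hΦ.aemeasurable, Measure.volume_eq_prod, lintegral_prod]
  · refine lintegral_congr fun t => ?_
    rw [lintegral_fin_succ]
    · simp
    · have h : Measurable fun w : Fin (n + 1) → ℝ => (Fin.tail w, (t, w 0)) :=
        (measurable_pi_lambda _ fun j => measurable_pi_apply j.succ).prodMk
          (measurable_const.prodMk (measurable_pi_apply 0))
      exact hΦ.comp h
  · exact hΦ.lintegral_prod_left'.aemeasurable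

theorem lintegral_extend {m : ℕ} {k a a₁ : ℝ} (hk : 0 < k) (ha : 0 < a)
    (hC : betaConst m k (a + a₁) = (m + 1)! / mehtaIntegral (m + 1) k (2 * (a + a₁)))
    (y : Fin (m + 1) → ℝ) {G : (Fin (m + 2) → ℝ) → ℝ≥0∞} (hG : Measurable G) :
    ∫⁻ z, ∫⁻ q : ℝ × ℝ, ENNReal.ofReal (gaussianPDFReal 0 (1 / (2 * a)).toNNReal q.1)
        * (ENNReal.ofReal (gammaDensity (((m : ℝ) + 1) * k) (2 * a) q.2
          * interlacedPDF m k (a + a₁) 0 (y, z)) * G (extend y z q.1 q.2))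
      = ∫⁻ x, ENNReal.ofReal (interlacedPDF (m + 1) k a a₁ (x, y)) * G x := by
  by_cases hy : StrictAnti y
  swap
  · have h : ∀ x, interlacedPDF (m + 1) k a a₁ (x, y) = 0 := fun x =>
      Set.indicator_of_notMem (fun h => hy (interlaced.strictAnti_snd h)) _
    simp [interlacedPDF_eq_zero k _ _ hy, h]
  have hN := measurable_gaussianPDFReal 0 (1 / (2 * a)).toNNReal
  have hγ := measurable_gammaDensity (((m : ℝ) + 1) * k) (2 * a)
  have hγ' := measurable_gammaDensity k (2 * a)
  have hR := measurable_secularRoots m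
  rw [lintegral_prod_eq_lintegral_cons]
  swap
  · refine (hN.comp (measurable_fst.comp measurable_snd)).ennreal_ofReal.mul
      (((hγ.comp (measurable_snd.comp measurable_snd)).mul
        ((measurable_interlacedPDF m k _ 0).comp
          (measurable_const.prodMk measurable_fst))).ennreal_ofReal.mul (hG.comp ?_))
    exact (measurable_extend m).comp
      ((measurable_const.prodMk measurable_fst).prodMk measurable_snd)
  simp only [extend_eq_secularRoots hy.injective]
  -- The integrand in the intermediate coordinates (α, c), where the two changes of variables meet.
  set K : (Fin (m + 2) → ℝ) → ℝ≥0∞ := fun v =>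
    ENNReal.ofReal (gaussianPDFReal 0 (1 / (2 * a)).toNNReal (v 0))
      * (ENNReal.ofReal (betaConst m k (a + a₁) * betaWeight k (a + a₁) y
          * ∏ i : Fin (m + 1), gammaDensity k (2 * a) (v i.succ)) * G (secularRoots y v)) with hK
  have hKm : Measurable K := by
    have h1 : Measurable fun v => G (secularRoots y v) :=
      hG.comp (hR.comp measurable_prodMk_left)
    have h2 : ∀ i : Fin (m + 1), Measurable fun v : Fin (m + 2) → ℝ =>
        gammaDensity k (2 * a) (v i.succ) := fun i => hγ'.comp (measurable_pi_apply _)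
    have h3 : Measurable fun v : Fin (m + 2) → ℝ =>
        gaussianPDFReal 0 (1 / (2 * a)).toNNReal (v 0) := hN.comp (measurable_pi_apply _)
    fun_prop
  have hpos : MeasurableSet {v : Fin (m + 2) → ℝ | ∀ j : Fin (m + 1), 0 < v j.succ} := by
    simp only [Set.ofPred_forall]
    exact MeasurableSet.iInter fun i => measurableSet_lt measurable_const (measurable_pi_apply _)
  have h1 : ∀ t, ∫⁻ w : Fin (m + 1) → ℝ,
      ENNReal.ofReal (gaussianPDFReal 0 (1 / (2 * a)).toNNReal t)
        * (ENNReal.ofReal (gammaDensity (((m : ℝ) + 1) * k) (2 * a) (w 0)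
          * interlacedPDF m k (a + a₁) 0 (y, Fin.tail w))
          * G (secularRoots y (Fin.cons t (residues y w))))
      = ∫⁻ v : Fin (m + 1) → ℝ, {v : Fin (m + 2) → ℝ | ∀ j : Fin (m + 1), 0 < v j.succ}.indicator K
          (Fin.cons t v) := by
    intro t
    rw [lintegral_const_mul' _ _ ENNReal.ofReal_ne_top,
      lintegral_gammaDensity_mul_interlacedPDF hk ha hy (fun v => G (secularRoots y (Fin.cons t v))),
      ← lintegral_const_mul' _ _ ENNReal.ofReal_ne_top,
      ← lintegral_indicator (measurableSet_forall_pos _)]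
    refine lintegral_congr fun v => ?_
    simp only [Set.indicator, Set.mem_ofPred_eq, Fin.cons_succ, hK, Fin.cons_zero]
  simp only [h1]
  rw [← lintegral_fin_succ (hKm.indicator hpos), lintegral_indicator hpos, lintegral_secular hy,
    ← lintegral_indicator (by
      exact (measurable_id.prodMk measurable_const) (measurableSet_interlaced (m + 1)))]
  refine lintegral_congr fun x => ?_
  by_cases hx : (x, y) ∈ interlaced (m + 1)
  · have e1 := absVandermonde_nonneg x
    have e2 := absVandermonde_nonneg y
    rw [Set.indicator_of_mem (by exact hx), ← gaussianPDF_mul_prod_gammaDensity ha hC hx, hK,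
      ENNReal.ofReal_mul (by positivity), ENNReal.ofReal_mul (gaussianPDFReal_nonneg _ _ _)]
    simp only [secularRoots_secular hx]
    ring
  · rw [Set.indicator_of_notMem (by exact hx), interlacedPDF, Set.indicator_of_notMem hx]
    simp

theorem map_extend {m : ℕ} {k a a₁ : ℝ} (hk : 0 < k) (ha : 0 < a) (haa₁ : 0 < a + a₁)
    [IsProbabilityMeasure (interlacedEnsemble m k (a + a₁) 0)] :
    ((interlacedEnsemble m k (a + a₁) 0).prod
      ((gaussianReal 0 (1 / (2 * a)).toNNReal).prod
        (gammaMeasure (((m : ℝ) + 1) * k) (2 * a)))).map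
      (fun p => (extend p.1.1 p.1.2 p.2.1 p.2.2, p.1.1))
      = interlacedEnsemble (m + 1) k a a₁ := by
  have hv : (1 / (2 * a)).toNNReal ≠ 0 := by
    rw [Ne, Real.toNNReal_eq_zero, not_le]; positivity
  have hs : 0 < ((m : ℝ) + 1) * k := by positivity
  have hN := (measurable_gaussianPDFReal 0 (1 / (2 * a)).toNNReal).ennreal_ofReal
  have hγ := (measurable_gammaDensity (((m : ℝ) + 1) * k) (2 * a)).ennreal_ofReal
  have hρ := (measurable_interlacedPDF m k (a + a₁) 0).ennreal_ofReal
  have hρ' := (measurable_interlacedPDF (m + 1) k a a₁).ennreal_ofReal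
  have hT : Measurable fun p : ((Fin (m + 1) → ℝ) × (Fin m → ℝ)) × (ℝ × ℝ) =>
      (extend p.1.1 p.1.2 p.2.1 p.2.2, p.1.1) :=
    (measurable_extend m).prodMk (measurable_fst.comp measurable_fst)
  refine Measure.ext_of_lintegral _ fun G hG => ?_
  have hGT : Measurable fun p : ((Fin (m + 1) → ℝ) × (Fin m → ℝ)) × (ℝ × ℝ) =>
      G (extend p.1.1 p.1.2 p.2.1 p.2.2, p.1.1) := hG.comp hT
  rw [lintegral_map hG hT, gaussianReal_of_var_ne_zero _ hv, gammaMeasure_eq, interlacedEnsemble,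
    interlacedEnsemble, prod_withDensity (by exact hN) hγ,
    prod_withDensity hρ (by exact (hN.comp measurable_fst).mul (hγ.comp measurable_snd)),
    lintegral_withDensity_eq_lintegral_mul _ hρ' hG,
    lintegral_withDensity_eq_lintegral_mul _ (by
      exact (hρ.comp measurable_fst).mul (((hN.comp measurable_fst).mul
        (hγ.comp measurable_snd)).comp measurable_snd)) hGT]
  have hF : Measurable fun p : ((Fin (m + 1) → ℝ) × (Fin m → ℝ)) × (ℝ × ℝ) =>
      ENNReal.ofReal (gaussianPDFReal 0 (1 / (2 * a)).toNNReal p.2.1)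
        * (ENNReal.ofReal (gammaDensity (((m : ℝ) + 1) * k) (2 * a) p.2.2
          * interlacedPDF m k (a + a₁) 0 p.1) * G (extend p.1.1 p.1.2 p.2.1 p.2.2, p.1.1)) := by
    refine (hN.comp (measurable_fst.comp measurable_snd)).mul (Measurable.mul ?_ hGT)
    exact (((measurable_gammaDensity _ _).comp (measurable_snd.comp measurable_snd)).mul
      ((measurable_interlacedPDF m k _ 0).comp measurable_fst)).ennreal_ofReal
  calc _ = ∫⁻ p : ((Fin (m + 1) → ℝ) × (Fin m → ℝ)) × (ℝ × ℝ),
      ENNReal.ofReal (gaussianPDFReal 0 (1 / (2 * a)).toNNReal p.2.1)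
        * (ENNReal.ofReal (gammaDensity (((m : ℝ) + 1) * k) (2 * a) p.2.2
          * interlacedPDF m k (a + a₁) 0 p.1) * G (extend p.1.1 p.1.2 p.2.1 p.2.2, p.1.1)) := by
        refine lintegral_congr fun p => ?_
        simp only [Pi.mul_apply, gaussianPDF,
          ENNReal.ofReal_mul (gammaDensity_nonneg hs (by positivity : 0 < 2 * a) _)]
        ring
    _ = ∫⁻ y, ∫⁻ z, ∫⁻ q : ℝ × ℝ,
      ENNReal.ofReal (gaussianPDFReal 0 (1 / (2 * a)).toNNReal q.1)
        * (ENNReal.ofReal (gammaDensity (((m : ℝ) + 1) * k) (2 * a) q.2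
          * interlacedPDF m k (a + a₁) 0 (y, z)) * G (extend y z q.1 q.2, y)) := by
        rw [Measure.volume_eq_prod, lintegral_prod _ hF.aemeasurable, Measure.volume_eq_prod,
          lintegral_prod _ hF.lintegral_prod_right'.aemeasurable]
    _ = ∫⁻ y, ∫⁻ x, ENNReal.ofReal (interlacedPDF (m + 1) k a a₁ (x, y)) * G (x, y) :=
        lintegral_congr fun y => lintegral_extend hk ha (betaConst_eq hk haa₁) y
          (hG.comp measurable_prodMk_right)
    _ = _ := by
        -- The shared spectrum y is the first coordinate of the smaller ensemble but the second of
        -- the larger one, hence the reversed order of integration.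
        rw [Measure.volume_eq_prod, lintegral_prod_symm _ (hρ'.mul hG).aemeasurable]
        rfl

/-! ### Size one, and the induction on the size. -/

theorem spectra_zero (d : Fin 1 → ℝ) (s : Fin 0 → ℝ) : spectra d s = (fun _ => d 0, default) := by
  refine Prod.ext ?_ (Subsingleton.elim _ _)
  have h := rootsOfValues_rootValues (x := fun _ : Fin 1 => d 0) fun i j _ => le_rfl
  simp only [spectra]
  rw [← h]
  congr 1
  funext t
  rw [Matrix.det_fin_one, Matrix.sub_apply, Matrix.scalar_apply, Matrix.diagonal_apply_eq]
  simp [rootValues, tridiag]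

theorem mehtaIntegral_zero (k c : ℝ) : mehtaIntegral 0 k c = 1 := by
  rw [mehtaIntegral, volume_pi, Measure.pi_of_empty, integral_dirac]
  simp [absVandermonde]

theorem interlacedPDF_zero (k a a₁ : ℝ) (ha : 0 < a) (p : (Fin 1 → ℝ) × (Fin 0 → ℝ)) :
    interlacedPDF 0 k a a₁ p = gaussianPDFReal 0 (1 / (2 * a)).toNNReal (p.1 0) := by
  rw [interlacedPDF, Set.indicator_of_mem (fun i => i.elim0), mehtaIntegral_zero,
    gaussianPDFReal_eq ha]
  simp [absVandermonde]

theorem map_gaussianReal (k a a₁ : ℝ) (ha : 0 < a) :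
    (gaussianReal 0 (1 / (2 * a)).toNNReal).map (fun t => ((fun _ => t, default) :
      (Fin 1 → ℝ) × (Fin 0 → ℝ))) = interlacedEnsemble 0 k a a₁ := by
  have hv : (1 / (2 * a)).toNNReal ≠ 0 := by
    rw [Ne, Real.toNNReal_eq_zero, not_le]; positivity
  have hN := (measurable_gaussianPDFReal 0 (1 / (2 * a)).toNNReal).ennreal_ofReal
  have hρ := (measurable_interlacedPDF 0 k a a₁).ennreal_ofReal
  have hT : Measurable fun t : ℝ => ((fun _ => t, default) : (Fin 1 → ℝ) × (Fin 0 → ℝ)) :=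
    (measurable_pi_lambda _ fun _ => measurable_id).prodMk measurable_const
  refine Measure.ext_of_lintegral _ fun G hG => ?_
  have hGT : Measurable fun t : ℝ => G (fun _ => t, default) := hG.comp hT
  have hI : Measurable fun x : Fin 1 → ℝ =>
      ENNReal.ofReal (interlacedPDF 0 k a a₁ (x, default)) * G (x, default) :=
    (hρ.mul hG).comp measurable_prodMk_right
  rw [lintegral_map hG hT, gaussianReal_of_var_ne_zero _ hv, interlacedEnsemble,
    lintegral_withDensity_eq_lintegral_mul _ hρ hG,
    lintegral_withDensity_eq_lintegral_mul _ (by exact hN) hGT,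
    Measure.volume_eq_prod, lintegral_prod _ (hρ.mul hG).aemeasurable]
  have h0 : ∀ f : (Fin 0 → ℝ) → ℝ≥0∞, ∫⁻ z, f z = f default := fun f => by
    rw [volume_pi, Measure.pi_of_empty _ default, lintegral_dirac]
  simp only [h0, Pi.mul_apply]
  rw [lintegral_fin_succ hI]
  refine lintegral_congr fun t => ?_
  rw [h0, interlacedPDF_zero k a a₁ ha]
  have h1 : (Fin.cons t default : Fin 1 → ℝ) = fun _ => t := by
    funext i; rw [Fin.fin_one_eq_zero i]; rfl
  rw [h1]
  rfl

theorem hasLaw_spectra {Ω : Type*} [MeasurableSpace Ω] (P : Measure Ω) [IsProbabilityMeasure P]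
    (m : ℕ) (k a a₁ : ℝ) (hk : 0 < k) (ha : 0 < a) (haa₁ : 0 < a + a₁)
    (d : Fin (m + 1) → Ω → ℝ) (b : Fin m → Ω → ℝ)
    (hd : ∀ i : Fin m,
      HasLaw (d i.castSucc) (gaussianReal 0 (1 / (2 * (a + a₁))).toNNReal) P)
    (hd_last : HasLaw (d (Fin.last m)) (gaussianReal 0 (1 / (2 * a)).toNNReal) P)
    (hb : ∀ i : Fin m, (i : ℕ) + 1 < m →
      HasLaw (fun ω => b i ω ^ 2) (gammaMeasure (((i : ℝ) + 1) * k) (2 * (a + a₁))) P)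
    (hb_last : ∀ i : Fin m, (i : ℕ) + 1 = m →
      HasLaw (fun ω => b i ω ^ 2) (gammaMeasure ((m : ℝ) * k) (2 * a)) P)
    (hindep : iIndepFun (Sum.elim d fun (i : Fin m) (ω : Ω) => b i ω ^ 2) P) :
    HasLaw (fun ω => spectra (fun i => d i ω) fun i => b i ω ^ 2)
      (interlacedEnsemble m k a a₁) P := by
  induction m generalizing a a₁ with
  | zero =>
    simp only [spectra_zero]
    have hT : Measurable fun t : ℝ => ((fun _ => t, default) : (Fin 1 → ℝ) × (Fin 0 → ℝ)) :=
      (measurable_pi_lambda _ fun _ => measurable_id).prodMk measurable_const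
    refine HasLaw.fun_comp (Y := fun t : ℝ => ((fun _ => t, default) :
      (Fin 1 → ℝ) × (Fin 0 → ℝ))) ⟨hT.aemeasurable, map_gaussianReal k a a₁ ha⟩ hd_last
  | succ m ih =>
    set f : Fin (m + 2) ⊕ Fin (m + 1) → Ω → ℝ :=
      Sum.elim d fun (i : Fin (m + 1)) (ω : Ω) => b i ω ^ 2 with hf
    have hfm : ∀ j, AEMeasurable (f j) P := by
      rintro (i | i)
      · induction i using Fin.lastCases with
        | last => exact hd_last.aemeasurable
        | cast i => exact (hd i).aemeasurable
      · obtain h | h := (Nat.succ_le_of_lt i.2).lt_or_eq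
        · exact (hb i h).aemeasurable
        · exact (hb_last i h).aemeasurable
    have hY : HasLaw (fun ω => spectra (fun i : Fin (m + 1) => d i.castSucc ω)
        fun i : Fin m => b i.castSucc ω ^ 2) (interlacedEnsemble m k (a + a₁) 0) P := by
      -- All entries of the submatrix, including its top ones, have parameter a + a₁, so its second
      -- parameter is 0.
      refine ih (a + a₁) 0 haa₁ (by rwa [add_zero]) (fun i => d i.castSucc)
        (fun i => b i.castSucc) (fun i => ?_) (hd (Fin.last m)) (fun i hi => ?_) (fun i hi => ?_) ?_
      · rw [add_zero]; exact hd i.castSucc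
      · rw [add_zero]
        exact hb i.castSucc (Nat.succ_lt_succ i.2)
      · have h := hb i.castSucc (Nat.succ_lt_succ i.2)
        have e : ((i.castSucc : ℕ) : ℝ) + 1 = m := by exact_mod_cast hi
        rwa [e] at h
      · have h := hindep.precomp (g := Sum.map Fin.castSucc Fin.castSucc)
          (Sum.map_injective.2 ⟨Fin.castSucc_injective _, Fin.castSucc_injective _⟩)
        convert h using 1
        funext j
        cases j <;> rfl
    -- Being the law of a random variable, the smaller ensemble has mass one; `map_extend` needs
    -- this for the normalizing constant.
    have hpm : IsProbabilityMeasure (interlacedEnsemble m k (a + a₁) 0) :=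
      hY.isProbabilityMeasure_iff.1 inferInstance
    have hs : 0 < ((m : ℝ) + 1) * k := by positivity
    have hgm : IsProbabilityMeasure (gammaMeasure (((m : ℝ) + 1) * k) (2 * a)) :=
      isProbabilityMeasure_gammaMeasure hs (by positivity)
    have hS : HasLaw (fun ω => b (Fin.last m) ω ^ 2)
        (gammaMeasure (((m : ℝ) + 1) * k) (2 * a)) P := by
      have h := hb_last (Fin.last m) rfl
      rwa [Nat.cast_add_one] at h
    have hAS : HasLaw (fun ω => (d (Fin.last (m + 1)) ω, b (Fin.last m) ω ^ 2))
        ((gaussianReal 0 (1 / (2 * a)).toNNReal).prod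
          (gammaMeasure (((m : ℝ) + 1) * k) (2 * a))) P :=
      (indepFun_iff_hasLaw_prodMk_prod hd_last hS).1
        (hindep.indepFun (i := Sum.inl (Fin.last (m + 1))) (j := Sum.inr (Fin.last m)) (by simp))
    -- `S` indexes the entries of the submatrix and `T` the two new entries, so (y, z) is
    -- independent of (α, s).
    obtain ⟨S, T, hST, hl, hr, hTl, hTr⟩ : ∃ S T : Finset (Fin (m + 2) ⊕ Fin (m + 1)),
        Disjoint S T ∧ (∀ i : Fin (m + 1), Sum.inl i.castSucc ∈ S)
        ∧ (∀ i : Fin m, Sum.inr i.castSucc ∈ S)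
        ∧ Sum.inl (Fin.last (m + 1)) ∈ T ∧ Sum.inr (Fin.last m) ∈ T := by
      refine ⟨Finset.univ.image (Sum.map Fin.castSucc Fin.castSucc),
        {Sum.inl (Fin.last (m + 1)), Sum.inr (Fin.last m)}, ?_,
        fun i => Finset.mem_image.2 ⟨Sum.inl i, Finset.mem_univ _, rfl⟩,
        fun i => Finset.mem_image.2 ⟨Sum.inr i, Finset.mem_univ _, rfl⟩, by simp, by simp⟩
      rw [Finset.disjoint_left]
      rintro _ h1 h2
      obtain ⟨i | i, -, rfl⟩ := Finset.mem_image.1 h1 <;> simp at h2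
    have hind := hindep.indepFun_finset₀ S T hST hfm
    have hpair : Measurable fun u : S → ℝ =>
        ((fun i : Fin (m + 1) => u ⟨Sum.inl i.castSucc, hl i⟩),
          fun i : Fin m => u ⟨Sum.inr i.castSucc, hr i⟩) :=
      (measurable_pi_lambda _ fun i => measurable_pi_apply _).prodMk
        (measurable_pi_lambda _ fun i => measurable_pi_apply _)
    have hψ : Measurable fun u : T → ℝ => (u ⟨Sum.inl (Fin.last (m + 1)), hTl⟩,
        u ⟨Sum.inr (Fin.last m), hTr⟩) :=
      (measurable_pi_apply _).prodMk (measurable_pi_apply _)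
    have hall := (indepFun_iff_hasLaw_prodMk_prod hY hAS).1 
      (hind.comp ((measurable_spectra m).comp hpair) hψ)
    have hT : Measurable fun p : ((Fin (m + 1) → ℝ) × (Fin m → ℝ)) × (ℝ × ℝ) =>
        (extend p.1.1 p.1.2 p.2.1 p.2.2, p.1.1) :=
      (measurable_extend m).prodMk (measurable_fst.comp measurable_fst)
    simp only [spectra_succ]
    exact HasLaw.fun_comp (Y := fun p : ((Fin (m + 1) → ℝ) × (Fin m → ℝ)) × (ℝ × ℝ) =>
      (extend p.1.1 p.1.2 p.2.1 p.2.2, p.1.1)) ⟨hT.aemeasurable, map_extend hk ha haa₁⟩ hall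

end GaussTridiag

theorem mainTheorem10 {Ω : Type*} [MeasurableSpace Ω] (P : Measure Ω) [IsProbabilityMeasure P]
    (m : ℕ) (k a a₁ : ℝ) (hk : 0 < k) (ha : 0 < a) (haa₁ : 0 < a + a₁)
    (d : Fin (m + 1) → Ω → ℝ) (b : Fin m → Ω → ℝ)
    (hd : ∀ i : Fin m,
      HasLaw (d i.castSucc) (gaussianReal 0 (1 / (2 * (a + a₁))).toNNReal) P)
    (hd_last : HasLaw (d (Fin.last m)) (gaussianReal 0 (1 / (2 * a)).toNNReal) P)
    (hb : ∀ i : Fin m, (i : ℕ) + 1 < m →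
      HasLaw (fun ω => b i ω ^ 2) (gammaMeasure (((i : ℝ) + 1) * k) (2 * (a + a₁))) P)
    (hb_last : ∀ i : Fin m, (i : ℕ) + 1 = m →
      HasLaw (fun ω => b i ω ^ 2) (gammaMeasure ((m : ℝ) * k) (2 * a)) P)
    (hindep : iIndepFun (Sum.elim d fun (i : Fin m) (ω : Ω) => b i ω ^ 2) P) :
    HasLaw
      (fun ω =>
        (GaussTridiag.orderedEigenvalues
            (GaussTridiag.tridiag_isHermitian (fun i => d i ω) (fun i => b i ω)),
         GaussTridiag.orderedEigenvalues
            (GaussTridiag.bottomRight_isHermitian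
              (GaussTridiag.tridiag_isHermitian (fun i => d i ω) (fun i => b i ω)))))
      (GaussTridiag.interlacedEnsemble m k a a₁) P := by
  simpa only [GaussTridiag.spectra_sq] using
    GaussTridiag.hasLaw_spectra P m k a a₁ hk ha haa₁ d b hd hd_last hb hb_last hindep
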